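/- Let $d\ge 2$, let $\Omega\subset\mathbb{R}^d$ be a bounded connected open set, and let $\varphi\in C(\partial\Omega)$ be Lipschitz continuous. A function $u\colon\Omega\to\mathbb{R}$ is called a variational solution of the Dirichlet problem with boundary data $\varphi$ if $u$ is harmonic on $\Omega$ and there is an extension $\Phi\in C(\overline{\Omega})$ of $\varphi$ with $\Phi-u\in H^1_0(\Omega)$. Here $H^1(\Omega)$ is the space of $u\in L^2(\Omega)$ whose weak partial derivatives $\partial_1u,\dots,\partial_du$ are in $L^2(\Omega)$, with norm $\bigl(\|u\|_{L^2}^2+\sum_j\|\partial_ju\|_{L^2}^2\bigr)^{1/2}$, and $H^1_0(\Omega)$ is the closure of $C_c^\infty(\Omega)$ in $H^1(\Omega)$. Then there is exactly one variational solution $u_\varphi$, and $u_\varphi\in H^1(\Omega)$; that is, it has finite energy: $\int_\Omega|\nabla u_\varphi|^2\,dx<\infty$. -/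

import Mathlib

open Set Filter Topology MeasureTheory TopologicalSpace
open scoped NNReal ENNReal Distributions

/-- `g` is the weak partial derivative `∂ⱼ u` on the open set `Ω`:
`∫_Ω u ∂ⱼw = - ∫_Ω g w` for every smooth `w` with compact support in `Ω`.
It is used below only for `u` and `g` that are square integrable on `Ω`, so that both integrals
converge. -/
def HasWeakPartialDeriv {d : ℕ} (Ω : Opens (EuclideanSpace ℝ (Fin d))) (j : Fin d)
    (u g : EuclideanSpace ℝ (Fin d) → ℝ) : Prop :=
  ∀ w : 𝓓(Ω, ℝ),
    ∫ x in (Ω : Set (EuclideanSpace ℝ (Fin d))),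
        u x * fderiv ℝ w x (EuclideanSpace.single j 1) =
      - ∫ x in (Ω : Set (EuclideanSpace ℝ (Fin d))), g x * w x

/-- `u ∈ H¹(Ω)` with weak gradient `g = (∂₁u, …, ∂_d u)`: the function `u` and its weak partial
derivatives `g j` belong to `L²(Ω)`. Values outside `Ω` play no role. -/
structure HasH1Gradient {d : ℕ} (Ω : Opens (EuclideanSpace ℝ (Fin d)))
    (u : EuclideanSpace ℝ (Fin d) → ℝ) (g : Fin d → EuclideanSpace ℝ (Fin d) → ℝ) : Prop where
  memLp : MemLp u 2 (volume.restrict (Ω : Set (EuclideanSpace ℝ (Fin d))))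
  memLp_grad : ∀ j, MemLp (g j) 2 (volume.restrict (Ω : Set (EuclideanSpace ℝ (Fin d))))
  weak : ∀ j, HasWeakPartialDeriv Ω j u (g j)

/-- `u ∈ H¹(Ω)`: `u ∈ L²(Ω)` and all first order weak partial derivatives are in `L²(Ω)`. -/
def MemH1 {d : ℕ} (Ω : Opens (EuclideanSpace ℝ (Fin d)))
    (u : EuclideanSpace ℝ (Fin d) → ℝ) : Prop :=
  ∃ g, HasH1Gradient Ω u g

/-- `v ∈ H¹₀(Ω)`, the closure of `C_c^∞(Ω)` in `H¹(Ω)`: `v ∈ H¹(Ω)`, and there are test functions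
`w n` such that `w n → v` and `∂ⱼ (w n) → ∂ⱼ v` in `L²(Ω)` for all `j`, that is, `w n → v` in the
norm of `H¹(Ω)`. -/
def MemH10 {d : ℕ} (Ω : Opens (EuclideanSpace ℝ (Fin d)))
    (v : EuclideanSpace ℝ (Fin d) → ℝ) : Prop :=
  ∃ g : Fin d → EuclideanSpace ℝ (Fin d) → ℝ, HasH1Gradient Ω v g ∧
    ∃ w : ℕ → 𝓓(Ω, ℝ),
      Tendsto (fun n => eLpNorm (fun x => w n x - v x) 2
        (volume.restrict (Ω : Set (EuclideanSpace ℝ (Fin d))))) atTop (𝓝 0) ∧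
      ∀ j, Tendsto
        (fun n => eLpNorm (fun x => fderiv ℝ (w n) x (EuclideanSpace.single j 1) - g j x) 2
          (volume.restrict (Ω : Set (EuclideanSpace ℝ (Fin d))))) atTop (𝓝 0)

/-- `u` (restricted to `Ω`) is a variational solution of the Dirichlet problem with boundary data
`φ ∈ C(∂Ω)`: it is harmonic on `Ω`, and there is an extension `Φ ∈ C(closure Ω)` of `φ` such that
`Φ - u ∈ H¹₀(Ω)`. Only the values of `u` on `Ω` and those of `Φ` on `closure Ω` matter. -/
def IsVariationalSolution {d : ℕ} (Ω : Opens (EuclideanSpace ℝ (Fin d)))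
    (φ : C(frontier (Ω : Set (EuclideanSpace ℝ (Fin d))), ℝ))
    (u : EuclideanSpace ℝ (Fin d) → ℝ) : Prop :=
  InnerProductSpace.HarmonicOnNhd u (Ω : Set (EuclideanSpace ℝ (Fin d))) ∧
    ∃ Φ : EuclideanSpace ℝ (Fin d) → ℝ,
      ContinuousOn Φ (closure (Ω : Set (EuclideanSpace ℝ (Fin d)))) ∧
      (∀ z : frontier (Ω : Set (EuclideanSpace ℝ (Fin d))), Φ z = φ z) ∧
      MemH10 Ω (fun x => Φ x - u x)

/-! Existence is the Dirichlet principle. The boundary data extend to a Lipschitz function `Φ` on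
the whole space, which lies in `H¹(Ω)`. Projecting its gradient in `L²(Ω)ᵈ` onto the closure of the
gradients of test functions gives the gradient of some `v ∈ H¹₀(Ω)`; Poincaré's inequality produces
`v` itself (`exists_memH10_orthogonal`). Then `Φ - v` is weakly harmonic, and Weyl's lemma replaces
it by a harmonic function equal to it almost everywhere. Its weak gradient is square integrable and
agrees almost everywhere with the classical one, so its energy is finite.

Uniqueness is less direct, since a competing solution may use an extension that is merely
continuous. The difference `u` of two solutions is harmonic and `Ψ - u ∈ H¹₀(Ω)` for some continuous
`Ψ` vanishing on the boundary, but neither `Ψ` nor `u` is known in advance to have finite energy.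
Let test functions `w n` tend to `Ψ - u`, and test harmonicity with `f = η G(u + w m - w n)`, where
`G` is a smooth truncation vanishing below `ε` and the cutoff `η` is `1` on the support of `w n` and
where `|Ψ| ≥ ε/2`. Two errors remain in the energy of `f`. One is the energy of `w m - w n`. The
other lives where `∇η ≠ 0`: there `u + w m - w n > ε` forces `w m` to differ from `Ψ - u` by at
least `ε/2`, so it is controlled by an `L²` distance. Choosing `m` after `n` makes both small.
Poincaré then gives `f → 0` in `L²`, whereas `f → G(u)` almost everywhere on `{u > ε}`, so `u ≤ ε`.
-/

/-! ### Laplacians of radial functions -/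

open Laplacian in
theorem laplacian_eq_sum_fderiv {d : ℕ} {w : EuclideanSpace ℝ (Fin d) → ℝ}
    {x : EuclideanSpace ℝ (Fin d)} (hw : ContDiffAt ℝ 2 w x) :
    Δ w x = ∑ j, fderiv ℝ (fun y => fderiv ℝ w y (EuclideanSpace.single j 1)) x
      (EuclideanSpace.single j 1) := by
  have hd : DifferentiableAt ℝ (fderiv ℝ w) x :=
    (hw.fderiv_right (m := 1) (by norm_num)).differentiableAt (by norm_num)
  rw [InnerProductSpace.laplacian_eq_iteratedFDeriv_orthonormalBasis w
    (EuclideanSpace.basisFun (Fin d) ℝ)]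
  refine Finset.sum_congr rfl fun j _ => ?_
  rw [iteratedFDeriv_two_apply, fderiv_clm_apply hd (differentiableAt_const _)]
  simp

theorem hasFDerivAt_comp_mul_norm_sub_sq {d : ℕ} {F : ℝ → ℝ} (hF : Differentiable ℝ F) (a : ℝ)
    (c x : EuclideanSpace ℝ (Fin d)) :
    HasFDerivAt (fun y => F (a * ‖y - c‖ ^ 2))
      (deriv F (a * ‖x - c‖ ^ 2) • a • (2 : ℝ) • innerSL ℝ (x - c)) x := by
  have h1 : HasFDerivAt (fun y : EuclideanSpace ℝ (Fin d) => ‖y - c‖ ^ 2)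
      ((2 : ℝ) • innerSL ℝ (x - c)) x := by
    refine ((hasFDerivAt_id x).sub_const c).norm_sq.congr_fderiv ?_
    ext v
    simp [two_smul]
  exact (hF _).hasDerivAt.comp_hasFDerivAt x (h1.const_mul a)

theorem fderiv_comp_mul_norm_sub_sq {d : ℕ} {F : ℝ → ℝ} (hF : Differentiable ℝ F) (a : ℝ)
    (c x : EuclideanSpace ℝ (Fin d)) (j : Fin d) :
    fderiv ℝ (fun y => F (a * ‖y - c‖ ^ 2)) x (EuclideanSpace.single j 1) =
      deriv F (a * ‖x - c‖ ^ 2) * (a * 2 * (x j - c j)) := by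
  rw [(hasFDerivAt_comp_mul_norm_sub_sq hF a c x).fderiv]
  simp [EuclideanSpace.inner_single_right, mul_assoc]

open Laplacian in
theorem laplacian_comp_mul_norm_sub_sq {d : ℕ} {F : ℝ → ℝ} (hF : ContDiff ℝ 2 F) (a : ℝ)
    (c x : EuclideanSpace ℝ (Fin d)) :
    Δ (fun y => F (a * ‖y - c‖ ^ 2)) x =
      4 * a ^ 2 * ‖x - c‖ ^ 2 * deriv (deriv F) (a * ‖x - c‖ ^ 2)
        + 2 * a * d * deriv F (a * ‖x - c‖ ^ 2) := by
  have hF1 : Differentiable ℝ F := hF.differentiable (by norm_num)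
  have hF2 : Differentiable ℝ (deriv F) :=
    (contDiff_succ_iff_deriv.1
      (show ContDiff ℝ (1 + 1) F by simpa [one_add_one_eq_two] using hF)).2.2.differentiable
        (by norm_num)
  have hcd : ContDiff ℝ 2 (fun y : EuclideanSpace ℝ (Fin d) => F (a * ‖y - c‖ ^ 2)) :=
    hF.comp (contDiff_const.mul ((contDiff_id.sub contDiff_const).norm_sq ℝ))
  rw [laplacian_eq_sum_fderiv hcd.contDiffAt]
  have key : ∀ j : Fin d, fderiv ℝ (fun y => fderiv ℝ (fun y => F (a * ‖y - c‖ ^ 2)) y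
      (EuclideanSpace.single j 1)) x (EuclideanSpace.single j 1) =
      4 * a ^ 2 * deriv (deriv F) (a * ‖x - c‖ ^ 2) * (x j - c j) ^ 2
        + 2 * a * deriv F (a * ‖x - c‖ ^ 2) := by
    intro j
    simp_rw [fderiv_comp_mul_norm_sub_sq hF1]
    have h1 := hasFDerivAt_comp_mul_norm_sub_sq hF2 a c x
    have h2 : HasFDerivAt (fun y : EuclideanSpace ℝ (Fin d) => a * 2 * (y j - c j))
        ((a * 2) • (EuclideanSpace.proj j : EuclideanSpace ℝ (Fin d) →L[ℝ] ℝ)) x :=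
      (((EuclideanSpace.proj j : EuclideanSpace ℝ (Fin d) →L[ℝ] ℝ).hasFDerivAt).sub_const
        (c j)).const_mul (a * 2)
    rw [(h1.fun_mul h2).fderiv]
    simp [EuclideanSpace.inner_single_right]
    ring
  simp_rw [key, Finset.sum_add_distrib, ← Finset.mul_sum]
  rw [EuclideanSpace.norm_sq_eq]
  simp
  ring

/-! ### Weyl's lemma by radial mollification -/

/-- A smooth antiderivative of a nonnegative bump, both vanishing on `[1, ∞)`. -/
theorem exists_smooth_monotone_eq_zero_of_one_le :
    ∃ F : ℝ → ℝ, ContDiff ℝ (⊤ : ℕ∞) F ∧ (∀ s, 1 ≤ s → F s = 0) ∧ (∀ s, 0 ≤ deriv F s) ∧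
      (∀ s, 1 < s → deriv F s = 0) ∧ 0 < deriv F 0 := by
  refine ⟨fun s => -expNegInvGlue (1 - s),
    (expNegInvGlue.contDiff.comp (contDiff_const.sub contDiff_id)).neg, ?_, ?_, ?_, ?_⟩
  · intro s hs
    simp [expNegInvGlue.zero_of_nonpos (sub_nonpos.2 hs)]
  · intro s
    apply Monotone.deriv_nonneg
    intro x y h
    exact neg_le_neg (expNegInvGlue.monotone (by linarith))
  · intro s hs
    have : (fun s : ℝ => -expNegInvGlue (1 - s)) =ᶠ[𝓝 s] fun _ => 0 := by
      filter_upwards [lt_mem_nhds hs] with t ht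
      simp [expNegInvGlue.zero_of_nonpos (sub_nonpos.2 ht.le)]
    rw [this.deriv_eq, deriv_const]
  -- For the polynomial `1` the derivative is `x⁻² * expNegInvGlue x`, and the factor `x⁻²` is `1`
  -- at `x = 1`.
  · have h := expNegInvGlue.hasDerivAt_polynomial_eval_inv_mul 1 (1 - (0 : ℝ))
    simp only [Polynomial.eval_one, one_mul] at h
    have h3 : HasDerivAt (fun s : ℝ => -expNegInvGlue (1 - s)) (expNegInvGlue 1) 0 :=
      (h.scomp (0 : ℝ) ((hasDerivAt_id (0 : ℝ)).const_sub 1)).neg.congr_deriv (by simp)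
    rw [h3.deriv]
    exact expNegInvGlue.pos_of_pos one_pos

-- All derivatives fall on the kernel, so local integrability of `f` suffices.
open scoped Laplacian Convolution in
theorem contDiff_and_laplacian_convolution {d : ℕ} {f k : EuclideanSpace ℝ (Fin d) → ℝ}
    (hf : LocallyIntegrable f) (hk : ContDiff ℝ 2 k) (hkc : HasCompactSupport k) :
    ContDiff ℝ 2 (f ⋆[ContinuousLinearMap.mul ℝ ℝ] k) ∧
      ∀ x, Δ (f ⋆[ContinuousLinearMap.mul ℝ ℝ] k) x = ∫ y, f y * Δ k (x - y) := by
  have hD : ∀ k : EuclideanSpace ℝ (Fin d) → ℝ, ContDiff ℝ 1 k → HasCompactSupport k →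
      ∀ v x, fderiv ℝ (f ⋆[ContinuousLinearMap.mul ℝ ℝ] k) x v =
        (f ⋆[ContinuousLinearMap.mul ℝ ℝ] fun y => fderiv ℝ k y v) x := by
    intro k hk hkc v x
    rw [(hkc.hasFDerivAt_convolution_right _ hf hk x).fderiv,
      convolution_precompR_apply _ hf (hkc.fderiv ℝ) (hk.continuous_fderiv one_ne_zero)]
  have hcd : ContDiff ℝ 2 (f ⋆[ContinuousLinearMap.mul ℝ ℝ] k) :=
    hkc.contDiff_convolution_right (n := 2) _ hf hk
  refine ⟨hcd, fun x => ?_⟩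
  have hk1 : ∀ v, ContDiff ℝ 1 fun y => fderiv ℝ k y v := fun v =>
    (hk.fderiv_right (m := 1) (by norm_num)).clm_apply contDiff_const
  have hkc1 : ∀ v, HasCompactSupport fun y => fderiv ℝ k y v := fun v =>
    hkc.fderiv_apply ℝ v
  rw [laplacian_eq_sum_fderiv hcd.contDiffAt]
  simp_rw [hD k (hk.of_le (by norm_num)) hkc, hD _ (hk1 _) (hkc1 _),
    laplacian_eq_sum_fderiv hk.contDiffAt, Finset.mul_sum]
  rw [integral_finsetSum]
  · rfl
  · intro j _
    exact ((hkc1 _).fderiv_apply ℝ _).convolutionExists_right (ContinuousLinearMap.mul ℝ ℝ) hf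
      (((hk1 _).continuous_fderiv one_ne_zero).clm_apply continuous_const) x

theorem tsupport_comp_mul_norm_sub_sq_subset {d : ℕ} {H : ℝ → ℝ} (hH : ∀ s, 1 < s → H s = 0)
    {t : ℝ} (ht : 0 < t) (c : EuclideanSpace ℝ (Fin d)) :
    tsupport (fun y => H (t ^ 2 * ‖y - c‖ ^ 2)) ⊆ Metric.closedBall c (1 / t) := by
  refine closure_minimal (fun y hy => ?_) Metric.isClosed_closedBall
  by_contra h
  apply hy
  rw [Metric.mem_closedBall, dist_eq_norm, not_le, div_lt_iff₀ ht] at h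
  refine hH _ ?_
  rw [← mul_pow]
  exact one_lt_pow₀ (by linarith) two_ne_zero

/-- The radial kernel `t ^ d * F' (t² |y|²)`, a dilate of `F' (|y|²)` with the same integral. -/
noncomputable def radialKernel {d : ℕ} (F : ℝ → ℝ) (t : ℝ) (y : EuclideanSpace ℝ (Fin d)) : ℝ :=
  t ^ d * deriv F (t ^ 2 * ‖y‖ ^ 2)

/-- Joint smoothness in the scale and the point is what allows differentiating the mollification in
`t`. -/
theorem contDiff_uncurry_radialKernel {d : ℕ} {F : ℝ → ℝ} (hF : ContDiff ℝ (⊤ : ℕ∞) F) :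
    ContDiff ℝ (⊤ : ℕ∞) (Function.uncurry (radialKernel (d := d) F)) := by
  have : ContDiff ℝ (⊤ : ℕ∞) (deriv F) := (contDiff_infty_iff_deriv.1 hF).2
  exact (contDiff_fst.pow d).mul
    (this.comp ((contDiff_fst.pow 2).mul (contDiff_snd.norm_sq ℝ)))

theorem radialKernel_eq_zero {d : ℕ} {F : ℝ → ℝ} (hF : ∀ s, 1 < s → deriv F s = 0) {t T : ℝ}
    (hT : 0 < T) (hTt : T ≤ t) {y : EuclideanSpace ℝ (Fin d)}
    (hy : y ∉ Metric.closedBall (0 : EuclideanSpace ℝ (Fin d)) (1 / T)) :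
    radialKernel F t y = 0 := by
  rw [Metric.mem_closedBall, dist_zero_right, not_le, div_lt_iff₀ hT] at hy
  rw [radialKernel, hF, mul_zero]
  rw [← mul_pow]
  exact one_lt_pow₀ (by nlinarith [norm_nonneg y]) two_ne_zero

theorem hasCompactSupport_radialKernel {d : ℕ} {F : ℝ → ℝ} (hF : ∀ s, 1 < s → deriv F s = 0)
    {t : ℝ} (ht : 0 < t) : HasCompactSupport (radialKernel (d := d) F t) :=
  HasCompactSupport.intro (isCompact_closedBall 0 (1 / t)) fun _ hy =>
    radialKernel_eq_zero hF ht le_rfl hy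

-- The `t`-derivative of the kernel is, up to the factor `2 t³ / tᵈ`, the Laplacian of `F (t²
-- |y|²)`, which is compactly supported because `F` itself vanishes on `[1, ∞)`. Weak harmonicity
-- annihilates it. This replaces the mean value property.
open scoped Laplacian Convolution in
theorem hasDerivAt_convolution_radialKernel {d : ℕ} {U : Set (EuclideanSpace ℝ (Fin d))}
    {f : EuclideanSpace ℝ (Fin d) → ℝ} (hf : LocallyIntegrable f)
    (hw : ∀ w : EuclideanSpace ℝ (Fin d) → ℝ, ContDiff ℝ (⊤ : ℕ∞) w → HasCompactSupport w →
      tsupport w ⊆ U → ∫ x, f x * Δ w x = 0)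
    {F : ℝ → ℝ} (hF : ContDiff ℝ (⊤ : ℕ∞) F) (hF0 : ∀ s, 1 ≤ s → F s = 0)
    (hF1 : ∀ s, 1 < s → deriv F s = 0) {x : EuclideanSpace ℝ (Fin d)} {t : ℝ} (ht : 0 < t)
    (hx : Metric.closedBall x (1 / t) ⊆ U) :
    HasDerivAt (fun t => (f ⋆[ContinuousLinearMap.mul ℝ ℝ] radialKernel F t) x) 0 t := by
  have hcd := contDiff_uncurry_radialKernel (d := d) hF
  have hFd : ContDiff ℝ (⊤ : ℕ∞) (deriv F) := (contDiff_infty_iff_deriv.1 hF).2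
  have h1 := hasFDerivAt_convolution_right_with_param (μ := volume) (ContinuousLinearMap.mul ℝ ℝ)
    -- For scales above `t / 2` all kernels are supported in one fixed ball.
    (g := radialKernel (d := d) F) (s := Ioi (t / 2)) (k := Metric.closedBall 0 (1 / (t / 2)))
    isOpen_Ioi (isCompact_closedBall _ _)
    (fun p y hp hy => radialKernel_eq_zero hF1 (half_pos ht) (le_of_lt hp) hy) hf
    ((hcd.of_le (mod_cast le_top)).contDiffOn) (t, x) (half_lt_self ht)
  have h2 : HasDerivAt (fun s : ℝ => (s, x)) ((1 : ℝ), (0 : EuclideanSpace ℝ (Fin d))) t :=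
    (hasDerivAt_id t).prodMk (hasDerivAt_const t x)
  refine (h1.comp_hasDerivAt t h2).congr_deriv ?_
  have hpart : ∀ y : EuclideanSpace ℝ (Fin d),
      fderiv ℝ (Function.uncurry (radialKernel F)) (t, y) (1, 0) =
        (d * t ^ (d - 1)) * deriv F (t ^ 2 * ‖y‖ ^ 2)
          + t ^ d * (deriv (deriv F) (t ^ 2 * ‖y‖ ^ 2) * (2 * t * ‖y‖ ^ 2)) := by
    intro y
    have h3 : HasDerivAt (fun s : ℝ => (s, y)) ((1 : ℝ), (0 : EuclideanSpace ℝ (Fin d))) t :=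
      (hasDerivAt_id t).prodMk (hasDerivAt_const t y)
    have h4 := ((hcd.differentiable (by simp)) (t, y)).hasFDerivAt.comp_hasDerivAt t h3
    have h5 : HasDerivAt (fun s : ℝ => s ^ 2 * ‖y‖ ^ 2) (2 * t * ‖y‖ ^ 2) t := by
      simpa using (hasDerivAt_pow 2 t).mul_const (‖y‖ ^ 2)
    have h6 := (hasDerivAt_pow d t).fun_mul
      (((hFd.differentiable (by simp)) _).hasDerivAt.comp t h5)
    exact h4.unique h6
  have hcont : Continuous fun y : EuclideanSpace ℝ (Fin d) =>
      fderiv ℝ (Function.uncurry (radialKernel F)) (t, y) :=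
    (hcd.continuous_fderiv (by simp)).comp (by fun_prop)
  have hcs : HasCompactSupport fun y : EuclideanSpace ℝ (Fin d) =>
      fderiv ℝ (Function.uncurry (radialKernel F)) (t, y) := by
    refine HasCompactSupport.intro (isCompact_closedBall 0 (1 / (t / 2))) fun y hy => ?_
    have : Function.uncurry (radialKernel F) =ᶠ[𝓝 (t, y)] fun _ => 0 := by
      have hopen : IsOpen (Ioi (t / 2) ×ˢ
          (Metric.closedBall (0 : EuclideanSpace ℝ (Fin d)) (1 / (t / 2)))ᶜ) :=
        isOpen_Ioi.prod Metric.isClosed_closedBall.isOpen_compl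
      filter_upwards [hopen.mem_nhds ⟨half_lt_self ht, hy⟩] with q hq
      exact radialKernel_eq_zero hF1 (half_pos ht) (le_of_lt hq.1) hq.2
    rw [this.fderiv_eq]
    simp
  have h7 := convolution_precompR_apply (ContinuousLinearMap.mul ℝ ℝ) hf hcs hcont x
    ((1 : ℝ), (0 : EuclideanSpace ℝ (Fin d)))
  refine h7.trans ?_
  have h8 := hw (fun y => F (t ^ 2 * ‖y - x‖ ^ 2))
    (hF.comp (contDiff_const.mul ((contDiff_id.sub contDiff_const).norm_sq ℝ)))
    (HasCompactSupport.of_support_subset_isCompact (isCompact_closedBall x (1 / t))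
      ((subset_tsupport _).trans
        (tsupport_comp_mul_norm_sub_sq_subset (fun s hs => hF0 s hs.le) ht x)))
    ((tsupport_comp_mul_norm_sub_sq_subset (fun s hs => hF0 s hs.le) ht x).trans hx)
  rw [convolution_def]
  have h9 : ∀ y, f y * Δ (fun y => F (t ^ 2 * ‖y - x‖ ^ 2)) y =
      (2 * t ^ 3 / t ^ d) *
        (f y * (fderiv ℝ (Function.uncurry (radialKernel F)) (t, x - y) (1, 0))) := by
    intro y
    rw [hpart, laplacian_comp_mul_norm_sub_sq (contDiff_infty.1 hF 2), norm_sub_rev y x]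
    -- The exponent `d - 1` is a truncated subtraction, so `d = 0` is separate.
    rcases d with _ | d
    · field_simp
      simp
      ring
    · field_simp
      simp
      ring
  simp_rw [h9] at h8
  rw [integral_const_mul] at h8
  exact (mul_eq_zero.1 h8).resolve_left (by positivity)

-- The translated kernel is itself an admissible test function, and by radial symmetry its Laplacian
-- is the same in `x - y` as in `y - x`.
open scoped Laplacian Convolution in
theorem laplacian_convolution_radialKernel {d : ℕ} {U : Set (EuclideanSpace ℝ (Fin d))}
    {f : EuclideanSpace ℝ (Fin d) → ℝ} (hf : LocallyIntegrable f)
    (hw : ∀ w : EuclideanSpace ℝ (Fin d) → ℝ, ContDiff ℝ (⊤ : ℕ∞) w → HasCompactSupport w →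
      tsupport w ⊆ U → ∫ x, f x * Δ w x = 0)
    {F : ℝ → ℝ} (hF : ContDiff ℝ (⊤ : ℕ∞) F) (hF1 : ∀ s, 1 < s → deriv F s = 0) {t : ℝ}
    (ht : 0 < t) :
    ContDiff ℝ 2 (f ⋆[ContinuousLinearMap.mul ℝ ℝ] radialKernel F t) ∧
    ∀ x : EuclideanSpace ℝ (Fin d), Metric.closedBall x (1 / t) ⊆ U →
      Δ (f ⋆[ContinuousLinearMap.mul ℝ ℝ] radialKernel F t) x = 0 := by
  have hFd : ContDiff ℝ (⊤ : ℕ∞) (deriv F) := (contDiff_infty_iff_deriv.1 hF).2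
  have hH : ContDiff ℝ (⊤ : ℕ∞) fun s => t ^ d * deriv F s := contDiff_const.mul hFd
  have hH1 : ∀ s, 1 < s → t ^ d * deriv F s = 0 := fun s hs => by simp [hF1 s hs]
  have hker : radialKernel (d := d) F t =
      fun y => (fun s => t ^ d * deriv F s) (t ^ 2 * ‖y - 0‖ ^ 2) := by
    ext y; simp [radialKernel]
  have hk : ContDiff ℝ 2 (radialKernel (d := d) F t) :=
    contDiff_infty.1 ((contDiff_uncurry_radialKernel (d := d) hF).comp
      (contDiff_const.prodMk contDiff_id)) 2
  obtain ⟨h1, h2⟩ := contDiff_and_laplacian_convolution hf hk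
    (hasCompactSupport_radialKernel hF1 ht)
  refine ⟨h1, fun x hx => ?_⟩
  have h8 := hw (fun y => (fun s => t ^ d * deriv F s) (t ^ 2 * ‖y - x‖ ^ 2))
    (hH.comp (contDiff_const.mul ((contDiff_id.sub contDiff_const).norm_sq ℝ)))
    (HasCompactSupport.of_support_subset_isCompact (isCompact_closedBall x (1 / t))
      ((subset_tsupport _).trans (tsupport_comp_mul_norm_sub_sq_subset hH1 ht x)))
    ((tsupport_comp_mul_norm_sub_sq_subset hH1 ht x).trans hx)
  rw [h2, ← h8]
  congr 1
  ext y
  rw [hker, laplacian_comp_mul_norm_sub_sq (contDiff_infty.1 hH 2),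
    laplacian_comp_mul_norm_sub_sq (contDiff_infty.1 hH 2), sub_zero, norm_sub_rev x y]

theorem radialKernel_eq_smul {d : ℕ} (F : ℝ → ℝ) (t : ℝ) (y : EuclideanSpace ℝ (Fin d)) :
    radialKernel F t y = t ^ d * radialKernel F 1 (t • y) := by
  simp [radialKernel, norm_smul, mul_pow]

theorem integral_radialKernel {d : ℕ} (F : ℝ → ℝ) {t : ℝ} (ht : 0 < t) :
    ∫ y, radialKernel (d := d) F t y = ∫ y, radialKernel (d := d) F 1 y := by
  simp_rw [radialKernel_eq_smul F t]
  rw [integral_const_mul, Measure.integral_comp_smul, finrank_euclideanSpace_fin,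
    abs_of_pos (by positivity), smul_eq_mul, ← mul_assoc, mul_inv_cancel₀ (by positivity), one_mul]

-- Lebesgue differentiation: the kernel at scale `t` lives on a ball of radius `1 / t` and is
-- bounded by a constant over the volume of that ball.
open scoped Convolution in
theorem ae_tendsto_convolution_radialKernel {d : ℕ} {f : EuclideanSpace ℝ (Fin d) → ℝ}
    (hf : LocallyIntegrable f) {F : ℝ → ℝ} (hF : ContDiff ℝ (⊤ : ℕ∞) F)
    (hF1 : ∀ s, 1 < s → deriv F s = 0) (hc : ∫ y, radialKernel (d := d) F 1 y ≠ 0) :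
    ∀ᵐ x, Tendsto (fun t => (∫ y, radialKernel (d := d) F 1 y)⁻¹ *
      (f ⋆[ContinuousLinearMap.mul ℝ ℝ] radialKernel F t) x) atTop (𝓝 (f x)) := by
  set c := ∫ y, radialKernel (d := d) F 1 y with hcdef
  have hk : Continuous (radialKernel (d := d) F 1) :=
    (contDiff_uncurry_radialKernel hF).continuous.comp (Continuous.prodMk_right (1 : ℝ))
  obtain ⟨C, hC⟩ := hk.bounded_above_of_compact_support
    (hasCompactSupport_radialKernel hF1 one_pos)
  filter_upwards [(Besicovitch.vitaliFamily volume).ae_tendsto_average_norm_sub hf] with x hx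
  have hrad : Tendsto (fun t : ℝ => 1 / t) atTop (𝓝[>] 0) := by
    simpa using tendsto_inv_atTop_nhdsGT_zero
  have h1 := (hx.comp (Besicovitch.tendsto_filterAt volume x)).comp hrad
  have h2 := tendsto_integral_smul_of_tendsto_average_norm_sub
    (g := fun (t : ℝ) y => c⁻¹ * radialKernel F t (x - y))
    (|c|⁻¹ * C * volume.real (Metric.closedBall (0 : EuclideanSpace ℝ (Fin d)) 1)) h1
    (Eventually.of_forall fun t => hf.integrableOn_isCompact (isCompact_closedBall _ _)) ?_ ?_ ?_
  · refine h2.congr fun t => ?_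
    rw [convolution_def, ← integral_const_mul]
    congr 1
    ext y
    simp
    ring
  · refine tendsto_const_nhds.congr' ?_
    filter_upwards [eventually_gt_atTop 0] with t ht
    rw [integral_const_mul, integral_sub_left_eq_self (radialKernel F t), integral_radialKernel F ht,
      inv_mul_cancel₀ hc]
  · filter_upwards [eventually_gt_atTop 0] with t ht y hy
    by_contra h
    apply hy
    change c⁻¹ * _ = 0
    rw [radialKernel_eq_zero hF1 ht le_rfl, mul_zero]
    rwa [Metric.mem_closedBall, dist_zero_right, ← dist_eq_norm, dist_comm]
  · filter_upwards [eventually_gt_atTop 0] with t ht y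
    have hpos : 0 < volume.real (Metric.closedBall (0 : EuclideanSpace ℝ (Fin d)) 1) :=
      ENNReal.toReal_pos (Metric.measure_closedBall_pos _ _ one_pos).ne'
        measure_closedBall_lt_top.ne
    rw [Measure.addHaar_real_closedBall' _ x (by positivity), finrank_euclideanSpace_fin,
      radialKernel_eq_smul, abs_mul, abs_mul, abs_inv, abs_of_pos (pow_pos ht d)]
    have h3 := hC (t • (x - y))
    rw [Real.norm_eq_abs] at h3
    have h4 : |c|⁻¹ * C * volume.real (Metric.closedBall (0 : EuclideanSpace ℝ (Fin d)) 1) /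
        ((1 / t) ^ d * volume.real (Metric.closedBall (0 : EuclideanSpace ℝ (Fin d)) 1)) =
        |c|⁻¹ * (t ^ d * C) := by
      rw [one_div, inv_pow]
      field_simp
    rw [h4]
    gcongr

open scoped Laplacian Convolution in
/-- **Weyl's lemma**: a weakly harmonic function agrees almost everywhere with a harmonic one. -/
theorem exists_harmonicOnNhd_ae_eq_of_integral_mul_laplacian {d : ℕ}
    {U : Set (EuclideanSpace ℝ (Fin d))} (hU : IsOpen U)
    {f : EuclideanSpace ℝ (Fin d) → ℝ} (hf : LocallyIntegrable f)
    (hw : ∀ w : EuclideanSpace ℝ (Fin d) → ℝ, ContDiff ℝ (⊤ : ℕ∞) w → HasCompactSupport w →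
      tsupport w ⊆ U → ∫ x, f x * Δ w x = 0) :
    ∃ u : EuclideanSpace ℝ (Fin d) → ℝ, InnerProductSpace.HarmonicOnNhd u U ∧
      u =ᵐ[volume.restrict U] f := by
  obtain ⟨F, hF, hF0, hFnn, hF1, hFpos⟩ := exists_smooth_monotone_eq_zero_of_one_le
  have hk : Continuous (radialKernel (d := d) F 1) :=
    (contDiff_uncurry_radialKernel hF).continuous.comp (Continuous.prodMk_right (1 : ℝ))
  have hc : 0 < ∫ y, radialKernel (d := d) F 1 y := by
    refine hk.integral_pos_of_hasCompactSupport_nonneg_nonzero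
      (hasCompactSupport_radialKernel hF1 one_pos) (fun y => ?_) (x := 0) ?_
    · simpa [radialKernel] using hFnn _
    · simpa [radialKernel] using hFpos.ne'
  set c := ∫ y, radialKernel (d := d) F 1 y with hcdef
  set v : ℝ → EuclideanSpace ℝ (Fin d) → ℝ :=
    fun t x => c⁻¹ * (f ⋆[ContinuousLinearMap.mul ℝ ℝ] radialKernel F t) x with hv
  have hconst : ∀ x : EuclideanSpace ℝ (Fin d), ∀ T > 0, Metric.closedBall x (1 / T) ⊆ U →
      ∀ t, T ≤ t → v t x = v T x := by
    intro x T hT hx t ht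
    have hder : ∀ s ∈ Ici T, HasDerivAt (fun t => v t x) 0 s := fun s hs => by
      have hs0 : 0 < s := hT.trans_le hs
      simpa using (hasDerivAt_convolution_radialKernel hf hw hF hF0 hF1 hs0
        ((Metric.closedBall_subset_closedBall
          (one_div_le_one_div_of_le hT hs)).trans hx)).const_mul c⁻¹
    exact (convex_Ici T).is_const_of_fderivWithin_eq_zero (𝕜 := ℝ) (f := fun t => v t x)
      (fun s hs => (hder s hs).differentiableAt.differentiableWithinAt)
      (fun s hs => by
        have := (hder s hs).hasDerivWithinAt (s := Ici T) |>.hasFDerivWithinAt.fderivWithin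
          (uniqueDiffOn_Ici T s hs)
        rw [this]; ext; simp) ht self_mem_Ici
  have hlim : ∀ x : EuclideanSpace ℝ (Fin d), ∀ T > 0, Metric.closedBall x (1 / T) ⊆ U →
      Tendsto (fun t => v t x) atTop (𝓝 (v T x)) := by
    intro x T hT hx
    refine tendsto_const_nhds.congr' ?_
    filter_upwards [eventually_ge_atTop T] with t ht using (hconst x T hT hx t ht).symm
  refine ⟨fun x => limUnder atTop fun t => v t x, fun x hx => ?_, ?_⟩
  -- At scale `4 / r`, the balls of radius `r / 4` about points of `ball x (r / 2)` stay in `U`, so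
  -- there the limit is a single mollification.
  · obtain ⟨r, hr, hrU⟩ := Metric.isOpen_iff.1 hU x hx
    have hball : ∀ y ∈ Metric.ball x (r / 2), Metric.closedBall y (1 / (4 / r)) ⊆ U := by
      intro y hy z hz
      apply hrU
      rw [Metric.mem_ball] at hy ⊢
      rw [Metric.mem_closedBall, one_div_div] at hz
      have := dist_triangle z y x
      linarith
    have hnhds : Metric.ball x (r / 2) ∈ 𝓝 x := Metric.ball_mem_nhds x (half_pos hr)
    have heq : (fun x => limUnder atTop fun t => v t x) =ᶠ[𝓝 x] v (4 / r) := by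
      filter_upwards [hnhds] with y hy
      exact (hlim y (4 / r) (by positivity) (hball y hy)).limUnder_eq
    rw [InnerProductSpace.harmonicAt_congr_nhds heq]
    obtain ⟨hcd, hlap⟩ := laplacian_convolution_radialKernel hf hw hF hF1
      (show (0 : ℝ) < 4 / r by positivity)
    refine ⟨(contDiff_const.mul hcd).contDiffAt, ?_⟩
    filter_upwards [hnhds] with y hy
    have := InnerProductSpace.laplacian_smul c⁻¹ (x := y) hcd.contDiffAt
    rw [hlap y (hball y hy), smul_zero] at this
    exact this
  · filter_upwards [ae_restrict_of_ae (ae_tendsto_convolution_radialKernel hf hF hF1 hc.ne')]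
      with x hx using hx.limUnder_eq

/-! ### Integration by parts, Poincaré's inequality, classical and weak derivatives -/

theorem continuous_mul_of_continuousOn_of_tsupport_subset {X : Type*} [TopologicalSpace X]
    {U : Set X} (hU : IsOpen U) {a b : X → ℝ} (ha : ContinuousOn a U) (hb : Continuous b)
    (hbU : tsupport b ⊆ U) : Continuous fun x => a x * b x := by
  refine continuous_of_tsupport fun x hx => ?_
  have hxU : x ∈ U := hbU (tsupport_mul_subset_right hx)
  exact (ha.continuousAt (hU.mem_nhds hxU)).mul hb.continuousAt

theorem integrable_mul_of_continuousOn_of_tsupport_subset {d : ℕ}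
    {U : Set (EuclideanSpace ℝ (Fin d))} (hU : IsOpen U) {a b : EuclideanSpace ℝ (Fin d) → ℝ}
    (ha : ContinuousOn a U) (hb : Continuous b) (hbc : HasCompactSupport b)
    (hbU : tsupport b ⊆ U) : Integrable fun x => a x * b x :=
  (continuous_mul_of_continuousOn_of_tsupport_subset hU ha hb hbU).integrable_of_hasCompactSupport
    hbc.mul_left

theorem ContDiffOn.continuousOn_fderiv_apply {d : ℕ} {U : Set (EuclideanSpace ℝ (Fin d))}
    (hU : IsOpen U) {u : EuclideanSpace ℝ (Fin d) → ℝ} (hu : ContDiffOn ℝ 1 u U)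
    (v : EuclideanSpace ℝ (Fin d)) : ContinuousOn (fun x => fderiv ℝ u x v) U :=
  (hu.continuousOn_fderiv_of_isOpen hU le_rfl).clm_apply continuousOn_const

/-- Integration by parts on an open set against a compactly supported function. -/
theorem integral_mul_fderiv_eq_neg_of_tsupport_subset {d : ℕ}
    {U : Set (EuclideanSpace ℝ (Fin d))} (hU : IsOpen U) {u w : EuclideanSpace ℝ (Fin d) → ℝ}
    (hu : ContDiffOn ℝ 1 u U) (hw : ContDiff ℝ 1 w) (hwc : HasCompactSupport w)
    (hwU : tsupport w ⊆ U) (v : EuclideanSpace ℝ (Fin d)) :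
    ∫ x, u x * fderiv ℝ w x v = - ∫ x, fderiv ℝ u x v * w x := by
  refine integral_mul_fderiv_eq_neg_fderiv_mul_of_integrable ?_ ?_ ?_ ?_ ?_
  · exact integrable_mul_of_continuousOn_of_tsupport_subset hU
      (hu.continuousOn_fderiv_apply hU v) hw.continuous hwc hwU
  · exact integrable_mul_of_continuousOn_of_tsupport_subset hU hu.continuousOn
      ((hw.continuous_fderiv one_ne_zero).clm_apply continuous_const) (hwc.fderiv_apply ℝ v)
      ((tsupport_fderiv_apply_subset ℝ v).trans hwU)
  · exact integrable_mul_of_continuousOn_of_tsupport_subset hU hu.continuousOn hw.continuous hwc hwU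
  · exact fun x hx => (hu.differentiableOn one_ne_zero).differentiableAt (hU.mem_nhds (hwU hx))
  · exact fun x _ => (hw.differentiable one_ne_zero) x

/-- **Poincaré's inequality** for a function supported in the slab `|xⱼ| ≤ R`. -/
theorem integral_sq_le_integral_fderiv_sq {d : ℕ} (j : Fin d) {R : ℝ}
    {f : EuclideanSpace ℝ (Fin d) → ℝ} (hf : ContDiff ℝ 1 f) (hfc : HasCompactSupport f)
    (hR : ∀ x, f x ≠ 0 → |x j| ≤ R) :
    ∫ x, f x ^ 2 ≤ 4 * R ^ 2 * ∫ x, fderiv ℝ f x (EuclideanSpace.single j 1) ^ 2 := by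
  set f' : EuclideanSpace ℝ (Fin d) → ℝ := fun x => fderiv ℝ f x (EuclideanSpace.single j 1) with hf'
  have hf'c : Continuous f' := (hf.continuous_fderiv one_ne_zero).clm_apply continuous_const
  have hf's : HasCompactSupport f' := hfc.fderiv_apply ℝ _
  have hproj : ContDiff ℝ 1 fun x : EuclideanSpace ℝ (Fin d) => x j :=
    (EuclideanSpace.proj j : EuclideanSpace ℝ (Fin d) →L[ℝ] ℝ).contDiff
  have hsq : ContDiff ℝ 1 fun x => f x ^ 2 := hf.pow 2
  have hsqc : HasCompactSupport fun x => f x ^ 2 := by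
    simp only [pow_two]
    exact hfc.mul_left (f := f)
  -- The coordinate `xⱼ` has derivative `1`, so `∫ f² = -∫ 2 xⱼ f ∂ⱼf`.
  have h1 := integral_mul_fderiv_eq_neg_of_tsupport_subset isOpen_univ hproj.contDiffOn hsq hsqc
    (subset_univ _) (EuclideanSpace.single j 1)
  have h2 : ∀ x : EuclideanSpace ℝ (Fin d), fderiv ℝ (fun x : EuclideanSpace ℝ (Fin d) => x j) x
      (EuclideanSpace.single j 1) = 1 := by
    intro x
    have := (EuclideanSpace.proj j : EuclideanSpace ℝ (Fin d) →L[ℝ] ℝ).hasFDerivAt (x := x)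
    have h3 : fderiv ℝ (fun x : EuclideanSpace ℝ (Fin d) => x j) x = EuclideanSpace.proj j :=
      this.fderiv
    rw [h3]; simp
  have h3 : ∀ x, fderiv ℝ (fun x => f x ^ 2) x (EuclideanSpace.single j 1) = 2 * f x * f' x := by
    intro x
    rw [((hf.differentiable one_ne_zero x).hasFDerivAt.pow 2).fderiv]
    simp [hf']
  simp_rw [h2, h3, one_mul] at h1
  have hi1 : Integrable fun x => f x ^ 2 := hsq.continuous.integrable_of_hasCompactSupport hsqc
  have hi2 : Integrable fun x => f' x ^ 2 :=
    (hf'c.pow 2).integrable_of_hasCompactSupport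
      (by simpa only [pow_two] using hf's.mul_left (f := f'))
  -- Young's inequality with weight `1/2`, so that half of `∫ f²` can be absorbed on the left.
  have h4 : ∫ x, f x ^ 2 ≤ ∫ x, ((1 / 2) * f x ^ 2 + 2 * R ^ 2 * f' x ^ 2) := by
    have h5 : ∫ x, f x ^ 2 = ∫ x : EuclideanSpace ℝ (Fin d), -(x j * (2 * f x * f' x)) := by
      rw [integral_neg, h1, neg_neg]
    rw [h5]
    refine integral_mono ?_ ((hi1.const_mul _).add (hi2.const_mul _)) fun x => ?_
    · refine Integrable.neg (Continuous.integrable_of_hasCompactSupport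
        (hproj.continuous.mul ((continuous_const.mul hf.continuous).mul hf'c)) ?_)
      exact (hf's.mul_left (f := fun x => 2 * f x)).mul_left
        (f := fun x : EuclideanSpace ℝ (Fin d) => x j)
    · by_cases h0 : f x = 0
      · simp only [h0]
        have : 0 ≤ R ^ 2 * f' x ^ 2 := by positivity
        nlinarith
      · have h6 : x j ^ 2 ≤ R ^ 2 := sq_le_sq' (neg_le_of_abs_le (hR x h0)) (le_of_abs_le (hR x h0))
        have h7 : x j ^ 2 * f' x ^ 2 ≤ R ^ 2 * f' x ^ 2 := by gcongr
        simp only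
        nlinarith [sq_nonneg (f x + 2 * x j * f' x)]
  rw [integral_add (hi1.const_mul _) (hi2.const_mul _), integral_const_mul, integral_const_mul] at h4
  linarith

/-- The fundamental lemma of the calculus of variations: integrated against test functions, the
classical and the weak derivative agree. This turns membership in `H¹(Ω)` into finiteness of the
classical energy. -/
theorem ContDiffOn.ae_eq_fderiv_of_hasWeakPartialDeriv {d : ℕ}
    {Ω : Opens (EuclideanSpace ℝ (Fin d))} {u g : EuclideanSpace ℝ (Fin d) → ℝ} {j : Fin d}
    (hu : ContDiffOn ℝ 1 u Ω)
    (hg : LocallyIntegrableOn g (Ω : Set (EuclideanSpace ℝ (Fin d))))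
    (h : HasWeakPartialDeriv Ω j u g) :
    (fun x => fderiv ℝ u x (EuclideanSpace.single j 1)) =ᵐ[volume.restrict
      (Ω : Set (EuclideanSpace ℝ (Fin d)))] g := by
  have hc := hu.continuousOn_fderiv_apply Ω.isOpen (EuclideanSpace.single j 1)
  have key := Ω.isOpen.ae_eq_zero_of_integral_contDiff_smul_eq_zero (μ := volume)
    (f := fun x => fderiv ℝ u x (EuclideanSpace.single j 1) - g x)
    ((hc.locallyIntegrableOn Ω.isOpen.measurableSet).sub hg) ?_
  · rw [Filter.EventuallyEq, ae_restrict_iff' Ω.isOpen.measurableSet]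
    filter_upwards [key] with x hx hxΩ using sub_eq_zero.1 (hx hxΩ)
  · intro w hw hwc hwΩ
    have h1 := h ⟨w, hw, hwc, hwΩ⟩
    rw [TestFunction.coe_mk] at h1
    have h2 := integral_mul_fderiv_eq_neg_of_tsupport_subset Ω.isOpen hu (hw.of_le (mod_cast le_top))
      hwc hwΩ (EuclideanSpace.single j 1)
    have hw0 : ∀ x ∉ (Ω : Set (EuclideanSpace ℝ (Fin d))), w x = 0 := fun x hx =>
      image_eq_zero_of_notMem_tsupport fun hx' => hx (hwΩ hx')
    have hw0' : ∀ x ∉ (Ω : Set (EuclideanSpace ℝ (Fin d))),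
        fderiv ℝ w x (EuclideanSpace.single j 1) = 0 := fun x hx =>
      image_eq_zero_of_notMem_tsupport (f := fun x => fderiv ℝ w x (EuclideanSpace.single j 1))
        fun hx' => hx (hwΩ (tsupport_fderiv_apply_subset ℝ _ hx'))
    rw [setIntegral_eq_integral_of_forall_compl_eq_zero fun x hx => by rw [hw0' x hx, mul_zero],
      setIntegral_eq_integral_of_forall_compl_eq_zero fun x hx => by rw [hw0 x hx, mul_zero],
      h2, neg_inj] at h1
    have hi1 := integrable_mul_of_continuousOn_of_tsupport_subset Ω.isOpen hc hw.continuous hwc hwΩ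
    have hi2 : Integrable fun x => g x * w x := by
      have := (hg.integrableOn_compact_subset hwΩ hwc).mul_continuousOn
        hw.continuous.continuousOn hwc
      rw [← integrableOn_iff_integrable_of_support_subset (s := tsupport w)]
      · exact this
      · exact fun x hx => subset_tsupport w (right_ne_zero_of_mul hx)
    simp_rw [smul_eq_mul, mul_comm (w _), sub_mul]
    rw [integral_sub hi1 hi2, h1, sub_self]

/-! ### Test functions and their gradients in `L²(Ω)` -/

theorem setIntegral_eq_integral_of_tsupport_subset {d : ℕ} {U : Set (EuclideanSpace ℝ (Fin d))}
    {a b : EuclideanSpace ℝ (Fin d) → ℝ} (hb : tsupport b ⊆ U) :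
    ∫ x in U, a x * b x = ∫ x, a x * b x :=
  setIntegral_eq_integral_of_forall_compl_eq_zero fun x hx => by
    rw [image_eq_zero_of_notMem_tsupport fun hx' => hx (hb hx'), mul_zero]

theorem inner_toLp_toLp {α : Type*} [MeasurableSpace α] {μ : Measure α} {f g : α → ℝ}
    (hf : MemLp f 2 μ) (hg : MemLp g 2 μ) :
    inner ℝ (hf.toLp f) (hg.toLp g) = ∫ x, f x * g x ∂μ := by
  rw [L2.inner_def]
  refine integral_congr_ae ?_
  filter_upwards [hf.coeFn_toLp, hg.coeFn_toLp] with x h1 h2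
  simp [h1, h2, mul_comm]

theorem norm_toLp_sq {α : Type*} [MeasurableSpace α] {μ : Measure α} {f : α → ℝ}
    (hf : MemLp f 2 μ) : ‖hf.toLp f‖ ^ 2 = ∫ x, f x ^ 2 ∂μ := by
  rw [← real_inner_self_eq_norm_sq, inner_toLp_toLp]
  simp_rw [pow_two]

namespace TestFunction

variable {d : ℕ} {Ω : Opens (EuclideanSpace ℝ (Fin d))}

theorem fderiv_add_apply (w₁ w₂ : 𝓓(Ω, ℝ)) (x v : EuclideanSpace ℝ (Fin d)) :
    fderiv ℝ (w₁ + w₂ : 𝓓(Ω, ℝ)) x v = fderiv ℝ w₁ x v + fderiv ℝ w₂ x v := by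
  have h1 := (w₁.contDiff.differentiable (by simp)) x
  have h2 := (w₂.contDiff.differentiable (by simp)) x
  rw [FunLike.coe_add, fderiv_add h1 h2]
  rfl

theorem fderiv_smul_apply (c : ℝ) (w : 𝓓(Ω, ℝ)) (x v : EuclideanSpace ℝ (Fin d)) :
    fderiv ℝ (c • w : 𝓓(Ω, ℝ)) x v = c * fderiv ℝ w x v := by
  have h1 := (w.contDiff.differentiable (by simp)) x
  rw [FunLike.coe_smul, fderiv_const_smul h1]
  rfl

theorem continuous_fderiv_apply (w : 𝓓(Ω, ℝ)) (v : EuclideanSpace ℝ (Fin d)) :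
    Continuous fun x => fderiv ℝ w x v :=
  (w.contDiff.continuous_fderiv (by simp)).clm_apply continuous_const

theorem memLp (w : 𝓓(Ω, ℝ)) {p : ℝ≥0∞} (s : Set (EuclideanSpace ℝ (Fin d))) :
    MemLp w p (volume.restrict s) :=
  (w.continuous.memLp_of_hasCompactSupport w.hasCompactSupport).restrict s

theorem memLp_fderiv_apply (w : 𝓓(Ω, ℝ)) (v : EuclideanSpace ℝ (Fin d)) {p : ℝ≥0∞}
    (s : Set (EuclideanSpace ℝ (Fin d))) :
    MemLp (fun x => fderiv ℝ w x v) p (volume.restrict s) :=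
  ((w.continuous_fderiv_apply v).memLp_of_hasCompactSupport
    (w.hasCompactSupport.fderiv_apply ℝ v)).restrict s

/-- A test function as an element of `L²(Ω)`. -/
noncomputable def toL2 :
    𝓓(Ω, ℝ) →ₗ[ℝ] Lp ℝ 2 (volume.restrict (Ω : Set (EuclideanSpace ℝ (Fin d)))) where
  toFun w := (w.memLp Ω).toLp w
  map_add' w₁ w₂ := by rw [← MemLp.toLp_add]; rfl
  map_smul' c w := by rw [RingHom.id_apply, ← MemLp.toLp_const_smul]; rfl

/-- A partial derivative of a test function as an element of `L²(Ω)`. -/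
noncomputable def derivToL2 (v : EuclideanSpace ℝ (Fin d)) :
    𝓓(Ω, ℝ) →ₗ[ℝ] Lp ℝ 2 (volume.restrict (Ω : Set (EuclideanSpace ℝ (Fin d)))) where
  toFun w := (w.memLp_fderiv_apply v Ω).toLp fun x => fderiv ℝ w x v
  map_add' w₁ w₂ := by
    rw [← MemLp.toLp_add]
    exact MemLp.toLp_congr _ _ (.of_forall fun x => w₁.fderiv_add_apply w₂ x v)
  map_smul' c w := by
    rw [RingHom.id_apply, ← MemLp.toLp_const_smul]
    exact MemLp.toLp_congr _ _ (.of_forall fun x => w.fderiv_smul_apply c x v)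

/-- The gradient of a test function as an element of `L²(Ω)ᵈ`. -/
noncomputable def gradToL2 :
    𝓓(Ω, ℝ) →ₗ[ℝ] PiLp 2
      fun _ : Fin d => Lp ℝ 2 (volume.restrict (Ω : Set (EuclideanSpace ℝ (Fin d)))) :=
  (WithLp.linearEquiv 2 ℝ _).symm.toLinearMap ∘ₗ
    LinearMap.pi fun j => derivToL2 (EuclideanSpace.single j 1)

theorem inner_derivToL2_toL2 (w₁ w₂ : 𝓓(Ω, ℝ)) (v : EuclideanSpace ℝ (Fin d)) :
    inner ℝ (toL2 w₁) (derivToL2 v w₂) = - inner ℝ (derivToL2 v w₁) (toL2 w₂) := by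
  have h1 : inner ℝ (toL2 w₁) (derivToL2 v w₂) = _ :=
    inner_toLp_toLp (w₁.memLp Ω) (w₂.memLp_fderiv_apply v Ω)
  have h2 : inner ℝ (derivToL2 v w₁) (toL2 w₂) = _ :=
    inner_toLp_toLp (w₁.memLp_fderiv_apply v Ω) (w₂.memLp Ω)
  rw [h1, h2, setIntegral_eq_integral_of_tsupport_subset
      ((tsupport_fderiv_apply_subset ℝ v).trans w₂.tsupport_subset),
    setIntegral_eq_integral_of_tsupport_subset w₂.tsupport_subset]
  exact integral_mul_fderiv_eq_neg_of_tsupport_subset isOpen_univ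
    (w₁.contDiff.of_le (mod_cast le_top)).contDiffOn (w₂.contDiff.of_le (mod_cast le_top))
    w₂.hasCompactSupport (subset_univ _) v

/-- Poincaré's inequality in the form needed to recover convergence of functions from convergence of
gradients. -/
theorem norm_toL2_le (j : Fin d) {R : ℝ} (hR0 : 0 ≤ R)
    (hR : ∀ x ∈ (Ω : Set (EuclideanSpace ℝ (Fin d))), |x j| ≤ R) (w : 𝓓(Ω, ℝ)) :
    ‖toL2 w‖ ≤ 2 * R * ‖gradToL2 w‖ := by
  have h1 : ‖toL2 w‖ ≤ 2 * R * ‖derivToL2 (EuclideanSpace.single j 1) w‖ := by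
    refine abs_le_of_sq_le_sq' ?_ (by positivity) |>.2
    rw [mul_pow]
    have h2 : ‖toL2 w‖ ^ 2 = _ := norm_toLp_sq (w.memLp Ω)
    have h3 : ‖derivToL2 (EuclideanSpace.single j 1) w‖ ^ 2 = _ :=
      norm_toLp_sq (w.memLp_fderiv_apply (EuclideanSpace.single j 1) Ω)
    rw [h2, h3]
    simp_rw [pow_two (fderiv ℝ _ _ _), pow_two (w _)]
    rw [setIntegral_eq_integral_of_tsupport_subset w.tsupport_subset,
      setIntegral_eq_integral_of_tsupport_subset
        ((tsupport_fderiv_apply_subset ℝ _).trans w.tsupport_subset)]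
    simp_rw [← pow_two (fderiv ℝ _ _ _), ← pow_two (w _)]
    have := integral_sq_le_integral_fderiv_sq j (w.contDiff.of_le (mod_cast le_top))
      w.hasCompactSupport
      (fun x hx => hR x (w.tsupport_subset (subset_tsupport _ hx)))
    rwa [show (2 * R) ^ 2 = 4 * R ^ 2 by ring]
  refine h1.trans ?_
  gcongr
  exact PiLp.norm_apply_le (gradToL2 w) j

end TestFunction

/-! ### Projection onto gradients of `H¹₀(Ω)` -/

theorem tendsto_eLpNorm_toLp_sub {α : Type*} [MeasurableSpace α] {μ : Measure α}
    {f : ℕ → α → ℝ} (hf : ∀ n, MemLp (f n) 2 μ) {g : Lp ℝ 2 μ}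
    (h : Tendsto (fun n => (hf n).toLp (f n)) atTop (𝓝 g)) :
    Tendsto (fun n => eLpNorm (fun x => f n x - g x) 2 μ) atTop (𝓝 0) := by
  refine (Lp.tendsto_Lp_iff_tendsto_eLpNorm' _ _ |>.1 h).congr fun n => eLpNorm_congr_ae ?_
  filter_upwards [(hf n).coeFn_toLp] with x hx
  simp [hx]

open TestFunction in
/-- The orthogonal projection of a square integrable vector field onto the gradients of functions
in `H¹₀(Ω)`. -/
theorem exists_memH10_orthogonal {d : ℕ} (hd : 0 < d) {Ω : Opens (EuclideanSpace ℝ (Fin d))}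
    (hbdd : Bornology.IsBounded (Ω : Set (EuclideanSpace ℝ (Fin d))))
    {g : Fin d → EuclideanSpace ℝ (Fin d) → ℝ}
    (hg : ∀ j, MemLp (g j) 2 (volume.restrict (Ω : Set (EuclideanSpace ℝ (Fin d))))) :
    ∃ (v : EuclideanSpace ℝ (Fin d) → ℝ) (p : Fin d → EuclideanSpace ℝ (Fin d) → ℝ),
      HasH1Gradient Ω v p ∧
      (∃ w : ℕ → 𝓓(Ω, ℝ),
        Tendsto (fun n => eLpNorm (fun x => w n x - v x) 2
          (volume.restrict (Ω : Set (EuclideanSpace ℝ (Fin d))))) atTop (𝓝 0) ∧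
        ∀ j, Tendsto
          (fun n => eLpNorm (fun x => fderiv ℝ (w n) x (EuclideanSpace.single j 1) - p j x) 2
            (volume.restrict (Ω : Set (EuclideanSpace ℝ (Fin d))))) atTop (𝓝 0)) ∧
      ∀ w : 𝓓(Ω, ℝ), ∑ j, ∫ x in (Ω : Set (EuclideanSpace ℝ (Fin d))),
        (g j x - p j x) * fderiv ℝ w x (EuclideanSpace.single j 1) = 0 := by
  set K := (LinearMap.range (gradToL2 (Ω := Ω))).topologicalClosure with hK
  have : CompleteSpace K := (Submodule.isClosed_topologicalClosure _).completeSpace_coe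
  set G : PiLp 2 fun _ : Fin d => Lp ℝ 2 (volume.restrict (Ω : Set (EuclideanSpace ℝ (Fin d)))) :=
    WithLp.toLp 2 fun j => (hg j).toLp (g j) with hG
  set P := K.starProjection G with hP
  have hPK : P ∈ K := K.starProjection_apply_mem G
  obtain ⟨y, hy, hlim⟩ := mem_closure_iff_seq_limit.1
    (show P ∈ closure (LinearMap.range (gradToL2 (Ω := Ω)) : Set _) from hPK)
  choose w hw using hy
  replace hlim : Tendsto (fun n => gradToL2 (w n)) atTop (𝓝 P) := by simpa only [hw] using hlim
  obtain ⟨R, hR0, hR⟩ : ∃ R : ℝ, 0 ≤ R ∧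
      ∀ x ∈ (Ω : Set (EuclideanSpace ℝ (Fin d))), |x ⟨0, hd⟩| ≤ R := by
    obtain ⟨R, hR0, hR⟩ := hbdd.exists_pos_norm_le
    refine ⟨R, hR0.le, fun x hx => ?_⟩
    have := (PiLp.norm_apply_le x ⟨0, hd⟩).trans (hR x hx)
    rwa [Real.norm_eq_abs] at this
  -- Only the gradients are known to converge; boundedness of `Ω` in one direction makes the
  -- functions Cauchy too.
  have hcau : CauchySeq fun n => toL2 (w n) := by
    have h1 := hlim.cauchySeq
    rw [Metric.cauchySeq_iff] at h1 ⊢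
    intro ε hε
    obtain ⟨N, hN⟩ := h1 (ε / (2 * R + 1)) (by positivity)
    refine ⟨N, fun m hm n hn => ?_⟩
    have h2 := hN m hm n hn
    rw [dist_eq_norm, ← map_sub] at h2 ⊢
    rw [lt_div_iff₀ (by positivity)] at h2
    have h3 := norm_toL2_le ⟨0, hd⟩ hR0 hR (w m - w n)
    nlinarith [norm_nonneg (gradToL2 (w m - w n))]
  obtain ⟨v, hv⟩ := cauchySeq_tendsto_of_complete hcau
  have hlimj : ∀ j, Tendsto (fun n => derivToL2 (EuclideanSpace.single j 1) (w n)) atTop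
      (𝓝 (P j)) := fun j => ((PiLp.continuous_apply 2 _ j).tendsto P).comp hlim
  refine ⟨v, fun j => P j, ⟨Lp.memLp v, fun j => Lp.memLp (P j), fun j φ => ?_⟩, ⟨w, ?_, ?_⟩, ?_⟩
  -- Integration by parts for `w n` passes to the limit on both sides.
  · have h1 : Tendsto (fun n => inner ℝ (toL2 (w n)) (derivToL2 (EuclideanSpace.single j 1) φ))
        atTop (𝓝 (inner ℝ v (derivToL2 (EuclideanSpace.single j 1) φ))) :=
      hv.inner tendsto_const_nhds
    have h2 : Tendsto (fun n => -inner ℝ (derivToL2 (EuclideanSpace.single j 1) (w n)) (toL2 φ))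
        atTop (𝓝 (-inner ℝ (P j) (toL2 φ))) := ((hlimj j).inner tendsto_const_nhds).neg
    simp_rw [inner_derivToL2_toL2] at h1
    have h3 := tendsto_nhds_unique h1 h2
    have h4 := inner_toLp_toLp (Lp.memLp v) (φ.memLp_fderiv_apply (EuclideanSpace.single j 1) Ω)
    have h5 := inner_toLp_toLp (Lp.memLp (P j)) (φ.memLp Ω)
    rw [Lp.toLp_coeFn] at h4 h5
    rw [← h4, ← h5]
    exact h3
  · exact tendsto_eLpNorm_toLp_sub (fun n => (w n).memLp Ω) hv
  · exact fun j => tendsto_eLpNorm_toLp_sub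
      (fun n => (w n).memLp_fderiv_apply (EuclideanSpace.single j 1) Ω) (hlimj j)
  · intro φ
    have h1 : inner ℝ (G - P) (gradToL2 φ) = 0 :=
      K.starProjection_inner_eq_zero G _ (subset_closure (LinearMap.mem_range_self gradToL2 φ))
    rw [PiLp.inner_apply] at h1
    rw [← h1]
    refine Finset.sum_congr rfl fun j _ => ?_
    have h4 := inner_toLp_toLp ((hg j).sub (Lp.memLp (P j)))
      (φ.memLp_fderiv_apply (EuclideanSpace.single j 1) Ω)
    rw [MemLp.toLp_sub (hg j) (Lp.memLp (P j)), Lp.toLp_coeFn] at h4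
    exact h4.symm

/-! ### Existence and finite energy -/

section Existence

variable {d : ℕ} {Ω : Opens (EuclideanSpace ℝ (Fin d))}

theorem HasH1Gradient.congr_ae {u u' : EuclideanSpace ℝ (Fin d) → ℝ}
    {g : Fin d → EuclideanSpace ℝ (Fin d) → ℝ} (h : HasH1Gradient Ω u g)
    (he : u =ᵐ[volume.restrict (Ω : Set (EuclideanSpace ℝ (Fin d)))] u') :
    HasH1Gradient Ω u' g where
  memLp := (memLp_congr_ae he).1 h.memLp
  memLp_grad := h.memLp_grad
  weak j w := by
    rw [← h.weak j w]
    refine integral_congr_ae ?_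
    filter_upwards [he] with x hx
    rw [hx]

theorem HasH1Gradient.sub {u₁ u₂ : EuclideanSpace ℝ (Fin d) → ℝ}
    {g₁ g₂ : Fin d → EuclideanSpace ℝ (Fin d) → ℝ} (h₁ : HasH1Gradient Ω u₁ g₁)
    (h₂ : HasH1Gradient Ω u₂ g₂) :
    HasH1Gradient Ω (fun x => u₁ x - u₂ x) (fun j x => g₁ j x - g₂ j x) where
  memLp := h₁.memLp.sub h₂.memLp
  memLp_grad j := (h₁.memLp_grad j).sub (h₂.memLp_grad j)
  weak j w := by
    have hw := w.memLp (p := 2) (Ω : Set (EuclideanSpace ℝ (Fin d)))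
    have hw' := w.memLp_fderiv_apply (EuclideanSpace.single j 1) (p := 2)
      (Ω : Set (EuclideanSpace ℝ (Fin d)))
    simp_rw [sub_mul]
    refine (integral_sub (h₁.memLp.integrable_mul hw') (h₂.memLp.integrable_mul hw')).trans
      (Eq.trans ?_ (congrArg Neg.neg (integral_sub ((h₁.memLp_grad j).integrable_mul hw)
        ((h₂.memLp_grad j).integrable_mul hw)).symm))
    have e₁ := h₁.weak j w
    have e₂ := h₂.weak j w
    simp only [Pi.mul_apply]
    linarith

theorem isFiniteMeasure_restrict_of_isBounded
    (hbdd : Bornology.IsBounded (Ω : Set (EuclideanSpace ℝ (Fin d)))) :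
    IsFiniteMeasure (volume.restrict (Ω : Set (EuclideanSpace ℝ (Fin d)))) :=
  ⟨by simpa using hbdd.measure_lt_top⟩

/-- A Lipschitz function is in `H¹(Ω)`. -/
theorem LipschitzWith.hasH1Gradient {C : ℝ≥0} {f : EuclideanSpace ℝ (Fin d) → ℝ}
    (hf : LipschitzWith C f)
    (hbdd : Bornology.IsBounded (Ω : Set (EuclideanSpace ℝ (Fin d)))) :
    HasH1Gradient Ω f fun j x => lineDeriv ℝ f x (EuclideanSpace.single j 1) where
  memLp := by
    have := isFiniteMeasure_restrict_of_isBounded hbdd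
    obtain ⟨R, hR⟩ := (hf.isBounded_image hbdd).exists_norm_le
    refine MemLp.of_bound hf.continuous.aestronglyMeasurable R ?_
    filter_upwards [ae_restrict_mem Ω.isOpen.measurableSet] with x hx
    exact hR _ (mem_image_of_mem f hx)
  memLp_grad j := by
    have := isFiniteMeasure_restrict_of_isBounded hbdd
    exact ((hf.memLp_lineDeriv (μ := volume) (EuclideanSpace.single j 1)).restrict _).mono_exponent
      le_top
  weak j w := by
    obtain ⟨D, hD⟩ := (w.contDiff.of_le (mod_cast le_top)).lipschitzWith_of_hasCompactSupport
      w.hasCompactSupport one_ne_zero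
    have h := hf.integral_lineDeriv_mul_eq (μ := volume) hD w.hasCompactSupport
      (EuclideanSpace.single j 1)
    have hd : ∀ x, lineDeriv ℝ w x (-EuclideanSpace.single j 1) * f x =
        -(f x * fderiv ℝ w x (EuclideanSpace.single j 1)) := fun x => by
      rw [((w.contDiff.differentiable (by simp)) x).lineDeriv_eq_fderiv, map_neg]
      ring
    simp_rw [hd] at h
    rw [setIntegral_eq_integral_of_tsupport_subset w.tsupport_subset, h, integral_neg, neg_neg,
      setIntegral_eq_integral_of_tsupport_subset
        ((tsupport_fderiv_apply_subset ℝ _).trans w.tsupport_subset)]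

/-- Weakly harmonic functions in `H¹(Ω)` are harmonic up to a null set. -/
theorem HasH1Gradient.exists_harmonicOnNhd {u : EuclideanSpace ℝ (Fin d) → ℝ}
    {g : Fin d → EuclideanSpace ℝ (Fin d) → ℝ} (h : HasH1Gradient Ω u g)
    (hbdd : Bornology.IsBounded (Ω : Set (EuclideanSpace ℝ (Fin d))))
    (hg : ∀ w : 𝓓(Ω, ℝ), ∑ j, ∫ x in (Ω : Set (EuclideanSpace ℝ (Fin d))),
        g j x * fderiv ℝ w x (EuclideanSpace.single j 1) = 0) :
    ∃ v : EuclideanSpace ℝ (Fin d) → ℝ,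
      InnerProductSpace.HarmonicOnNhd v (Ω : Set (EuclideanSpace ℝ (Fin d))) ∧
      v =ᵐ[volume.restrict (Ω : Set (EuclideanSpace ℝ (Fin d)))] u := by
  have := isFiniteMeasure_restrict_of_isBounded hbdd
  have hmeas := Ω.isOpen.measurableSet
  -- Weyl's lemma is stated for functions on the whole space, hence the extension by zero.
  have hint : Integrable ((Ω : Set (EuclideanSpace ℝ (Fin d))).indicator u) :=
    (integrable_indicator_iff hmeas).2 (h.memLp.integrable one_le_two)
  suffices hw : _ from
    (exists_harmonicOnNhd_ae_eq_of_integral_mul_laplacian Ω.isOpen hint.locallyIntegrable hw).imp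
      fun v hv => ⟨hv.1, hv.2.trans (indicator_ae_eq_restrict hmeas)⟩
  intro w hw hwc hwΩ
  have hcd : ∀ j : Fin d, ContDiff ℝ (⊤ : ℕ∞) fun x => fderiv ℝ w x (EuclideanSpace.single j 1) :=
    fun j => (contDiff_infty_iff_fderiv.1 hw).2.clm_apply contDiff_const
  -- Testing the weak derivatives of `u` with `∂ⱼw` turns `∫ u Δw` into `-∑ⱼ ∫ gⱼ ∂ⱼw`.
  let W : Fin d → 𝓓(Ω, ℝ) := fun j => ⟨fun x => fderiv ℝ w x (EuclideanSpace.single j 1), hcd j,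
    hwc.fderiv_apply ℝ _, (tsupport_fderiv_apply_subset ℝ _).trans hwΩ⟩
  have h1 : ∀ x, (Ω : Set (EuclideanSpace ℝ (Fin d))).indicator u x * Laplacian.laplacian w x =
      (Ω : Set (EuclideanSpace ℝ (Fin d))).indicator
        (fun x => ∑ j, u x * fderiv ℝ (W j) x (EuclideanSpace.single j 1)) x := by
    intro x
    by_cases hx : x ∈ (Ω : Set (EuclideanSpace ℝ (Fin d)))
    · rw [indicator_of_mem hx, indicator_of_mem hx, ← Finset.mul_sum,
        laplacian_eq_sum_fderiv (contDiff_infty.1 hw 2).contDiffAt]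
      rfl
    · simp [indicator_of_notMem hx]
  have hi : ∀ j, IntegrableOn (fun x => u x * fderiv ℝ (W j) x (EuclideanSpace.single j 1)) Ω :=
    fun j => h.memLp.integrable_mul
      ((W j).memLp_fderiv_apply (EuclideanSpace.single j 1) (p := 2) _)
  simp_rw [h1]
  rw [integral_indicator hmeas, integral_finsetSum _ fun j _ => hi j]
  simp_rw [h.weak _ (W _)]
  rw [Finset.sum_neg_distrib, neg_eq_zero]
  exact hg ⟨w, hw, hwc, hwΩ⟩

theorem enorm_gradient_sq (u : EuclideanSpace ℝ (Fin d) → ℝ) (x : EuclideanSpace ℝ (Fin d)) :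
    ‖gradient u x‖ₑ ^ 2 = ∑ j, ‖fderiv ℝ u x (EuclideanSpace.single j 1)‖ₑ ^ 2 := by
  have hj : ∀ j, fderiv ℝ u x (EuclideanSpace.single j 1) = gradient u x j := fun j => by
    rw [← inner_gradient_left, EuclideanSpace.inner_single_right]
    simp
  have h := EuclideanSpace.norm_sq_eq (gradient u x)
  simp_rw [hj, ← ofReal_norm, ← ENNReal.ofReal_pow (norm_nonneg _)]
  rw [h, ENNReal.ofReal_sum_of_nonneg fun _ _ => by positivity]

theorem HasH1Gradient.lintegral_gradient_lt_top {u : EuclideanSpace ℝ (Fin d) → ℝ}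
    {g : Fin d → EuclideanSpace ℝ (Fin d) → ℝ} (h : HasH1Gradient Ω u g)
    (hu : ContDiffOn ℝ 1 u Ω) :
    ∫⁻ x in (Ω : Set (EuclideanSpace ℝ (Fin d))), ‖gradient u x‖ₑ ^ 2 < ⊤ := by
  have hae : ∀ᵐ x ∂volume.restrict (Ω : Set (EuclideanSpace ℝ (Fin d))),
      ∀ j, fderiv ℝ u x (EuclideanSpace.single j 1) = g j x :=
    ae_all_iff.2 fun j => hu.ae_eq_fderiv_of_hasWeakPartialDeriv
      (locallyIntegrableOn_of_locallyIntegrable_restrict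
        ((h.memLp_grad j).locallyIntegrable one_le_two)) (h.weak j)
  rw [lintegral_congr_ae (g := fun x => ∑ j, ‖g j x‖ₑ ^ 2) (by
    filter_upwards [hae] with x hx
    simp_rw [enorm_gradient_sq, hx])]
  rw [lintegral_finsetSum' _ fun j _ =>
    (h.memLp_grad j).aestronglyMeasurable.enorm.pow_const 2]
  refine ENNReal.sum_lt_top.2 fun j _ => ?_
  simpa using lintegral_rpow_enorm_lt_top_of_eLpNorm_lt_top two_ne_zero ENNReal.ofNat_ne_top
    (h.memLp_grad j).2

theorem exists_lipschitzWith_extension {X : Type*} [PseudoMetricSpace X] {s : Set X} {φ : s → ℝ}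
    {K : ℝ≥0} (hφ : LipschitzWith K φ) :
    ∃ f : X → ℝ, LipschitzWith K f ∧ ∀ z : s, f z = φ z := by
  classical
  obtain ⟨f, hf, he⟩ := LipschitzOnWith.extend_real (K := K) (s := s)
    (f := fun x => if h : x ∈ s then φ ⟨x, h⟩ else 0) (fun x hx y hy => by
      simpa [hx, hy] using hφ ⟨x, hx⟩ ⟨y, hy⟩)
  exact ⟨f, hf, fun z => by rw [← he z.2]; simp⟩

/-- The Dirichlet principle: the Lipschitz extension minus its `H¹₀` part is weakly harmonic, and
its harmonic representative is the solution. -/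
theorem exists_isVariationalSolution (hd : 0 < d)
    (hbdd : Bornology.IsBounded (Ω : Set (EuclideanSpace ℝ (Fin d))))
    {φ : C(frontier (Ω : Set (EuclideanSpace ℝ (Fin d))), ℝ)} {K : ℝ≥0}
    (hφ : LipschitzWith K φ) :
    ∃ u g, IsVariationalSolution Ω φ u ∧ HasH1Gradient Ω u g := by
  obtain ⟨Φ, hΦ, hΦφ⟩ := exists_lipschitzWith_extension hφ
  have hΦ1 := hΦ.hasH1Gradient hbdd
  obtain ⟨v, p, hvp, ⟨w, hw, hw'⟩, horth⟩ := exists_memH10_orthogonal hd hbdd hΦ1.memLp_grad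
  obtain ⟨u, hu, huv⟩ := (hΦ1.sub hvp).exists_harmonicOnNhd hbdd horth
  have hv : v =ᵐ[volume.restrict (Ω : Set (EuclideanSpace ℝ (Fin d)))] fun x => Φ x - u x := by
    filter_upwards [huv] with x hx
    rw [hx]; ring
  refine ⟨u, _, ⟨hu, Φ, hΦ.continuous.continuousOn, hΦφ, p, hvp.congr_ae hv, w,
    hw.congr fun n => eLpNorm_congr_ae ?_, hw'⟩, (hΦ1.sub hvp).congr_ae huv.symm⟩
  filter_upwards [hv] with x hx
  rw [hx]

end Existence

/-! ### Energy estimate for truncated harmonic functions -/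

section Uniqueness

variable {d : ℕ} {Ω : Opens (EuclideanSpace ℝ (Fin d))}

theorem contDiff_mul_of_tsupport_subset {E : Type*} [NormedAddCommGroup E] [NormedSpace ℝ E]
    {U : Set E} (hU : IsOpen U) {n : WithTop ℕ∞} {a b : E → ℝ} (ha : ContDiffOn ℝ n a U)
    (hb : ContDiff ℝ n b) (hbU : tsupport b ⊆ U) : ContDiff ℝ n fun x => a x * b x := by
  refine contDiff_iff_contDiffAt.2 fun x => ?_
  by_cases hx : x ∈ tsupport b
  · exact (ha.contDiffAt (hU.mem_nhds (hbU hx))).mul hb.contDiffAt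
  · refine contDiffAt_const (c := (0 : ℝ)) |>.congr_of_eventuallyEq ?_
    filter_upwards [notMem_tsupport_iff_eventuallyEq.1 hx] with y hy
    simp [hy]

/-- Smooth cutoff functions between a compact set and an open set. -/
theorem TestFunction.exists_eventually_eq_one {K : Set (EuclideanSpace ℝ (Fin d))}
    (hK : IsCompact K) (hKΩ : K ⊆ Ω) :
    ∃ η : 𝓓(Ω, ℝ), (∀ x ∈ K, ∀ᶠ y in 𝓝 x, η y = 1) ∧ ∀ x, η x ∈ Icc (0 : ℝ) 1 := by
  obtain ⟨L, hL, hKL, hLΩ⟩ := exists_compact_between hK Ω.isOpen hKΩ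
  obtain ⟨f, hf1, hf0, hf⟩ := exists_contMDiffMap_one_nhds_of_subset_interior
    (modelWithCornersSelf ℝ (EuclideanSpace ℝ (Fin d))) (n := (⊤ : ℕ∞)) hK.isClosed hKL
  have hsupp : tsupport f ⊆ L := closure_minimal (fun x hx => by
    by_contra h
    exact hx (hf0 x h)) hL.isClosed
  exact ⟨⟨f, f.contMDiff.contDiff, hL.of_isClosed_subset (isClosed_tsupport _) hsupp,
    hsupp.trans hLΩ⟩, fun x hx => eventually_nhdsSet_iff_forall.1 hf1 x hx, hf⟩

/-- A harmonic function is orthogonal to compactly supported functions in the Dirichlet inner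
product. -/
theorem InnerProductSpace.HarmonicOnNhd.sum_integral_fderiv_mul_fderiv_eq_zero
    {u f : EuclideanSpace ℝ (Fin d) → ℝ}
    (hu : HarmonicOnNhd u (Ω : Set (EuclideanSpace ℝ (Fin d)))) (hf : ContDiff ℝ 1 f)
    (hfc : HasCompactSupport f) (hfΩ : tsupport f ⊆ Ω) :
    ∑ j, ∫ x in (Ω : Set (EuclideanSpace ℝ (Fin d))),
      fderiv ℝ u x (EuclideanSpace.single j 1) * fderiv ℝ f x (EuclideanSpace.single j 1) = 0 := by
  have hu1 : ∀ j, ContDiffOn ℝ 1 (fun x => fderiv ℝ u x (EuclideanSpace.single j 1)) Ω := fun j =>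
    (hu.contDiffOn.fderiv_of_isOpen Ω.isOpen (by norm_num)).clm_apply contDiffOn_const
  have hi : ∀ j, Integrable fun x => fderiv ℝ (fun x => fderiv ℝ u x (EuclideanSpace.single j 1)) x
      (EuclideanSpace.single j 1) * f x := fun j =>
    integrable_mul_of_continuousOn_of_tsupport_subset Ω.isOpen
      ((hu1 j).continuousOn_fderiv_apply Ω.isOpen _) hf.continuous hfc hfΩ
  have h1 : ∀ j : Fin d, ∫ x in (Ω : Set (EuclideanSpace ℝ (Fin d))),
      fderiv ℝ u x (EuclideanSpace.single j 1) * fderiv ℝ f x (EuclideanSpace.single j 1) =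
      -∫ x, fderiv ℝ (fun x => fderiv ℝ u x (EuclideanSpace.single j 1)) x
        (EuclideanSpace.single j 1) * f x := fun j => by
    rw [setIntegral_eq_integral_of_tsupport_subset
      ((tsupport_fderiv_apply_subset ℝ _).trans hfΩ),
      integral_mul_fderiv_eq_neg_of_tsupport_subset Ω.isOpen (hu1 j) hf hfc hfΩ]
  simp_rw [h1]
  rw [Finset.sum_neg_distrib, ← integral_finsetSum _ fun j _ => hi j, neg_eq_zero]
  refine integral_eq_zero_of_ae (.of_forall fun x => ?_)
  change ∑ j, _ * f x = 0
  rw [← Finset.sum_mul]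
  by_cases hx : x ∈ tsupport f
  · have h := hu x (hfΩ hx)
    rw [← laplacian_eq_sum_fderiv h.1, h.2.self_of_nhds]
    simp
  · simp [image_eq_zero_of_notMem_tsupport hx]

/-- Here `a`, `e`, `h` stand for partial derivatives of `u`, of the perturbation and of the cutoff,
and the squared quantity is that of `∂ⱼ(η G(u + e))`. The point is to bound the square by a multiple
of `∂ⱼu ∂ⱼf`, whose sum over `j` integrates to zero, plus controllable errors. -/
theorem sq_deriv_cutoff_le {C G G' η a e h : ℝ} (hG0 : 0 ≤ G) (hG1 : G ≤ 1) (hG'0 : 0 ≤ G')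
    (hG'C : G' ≤ C) (hη0 : 0 ≤ η) (hη1 : η ≤ 1) :
    (G' * (a + e) * η + G * h) ^ 2 ≤ 8 * C * (a * (G' * (a + e) * η + G * h)) +
      8 * C ^ 2 * e ^ 2 + G * ((8 * C * |a| + 2 * |h|) * |h|) := by
  have hC : 0 ≤ C := hG'0.trans hG'C
  have hp0 : 0 ≤ G' * η := by positivity
  have hpC : G' * η ≤ C := (mul_le_of_le_one_right hG'0 hη1).trans hG'C
  set p := G' * η with hp
  have h1 : (G' * (a + e) * η + G * h) ^ 2 ≤ 2 * (p * (a + e)) ^ 2 + 2 * (G * h) ^ 2 := by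
    have : G' * (a + e) * η = p * (a + e) := by rw [hp]; ring
    rw [this]
    nlinarith [sq_nonneg (p * (a + e) - G * h)]
  have h2 : (p * (a + e)) ^ 2 ≤ C * p * (a + e) ^ 2 := by
    rw [mul_pow]
    gcongr
    nlinarith
  have h3 : (G * h) ^ 2 ≤ G * h ^ 2 := by
    rw [mul_pow]
    gcongr
    nlinarith
  have h4 : -(a * (G * h)) ≤ G * (|a| * |h|) := by
    have h5 : -(a * h) ≤ |a| * |h| := by rw [← abs_mul]; exact neg_le_abs _
    calc -(a * (G * h)) = G * -(a * h) := by ring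
      _ ≤ G * (|a| * |h|) := by gcongr
  -- With `p e² ≤ C e²` this reduces to `6a² + 4ae + 6e² ≥ 0`.
  have h6 : C * p * (a + e) ^ 2 * 2 ≤ 8 * C * (a * (p * (a + e))) + 8 * C ^ 2 * e ^ 2 := by
    have h7 : 0 ≤ C * p * (6 * a ^ 2 + 4 * a * e + 6 * e ^ 2) :=
      mul_nonneg (by positivity) (by nlinarith [sq_nonneg (a + e)])
    have h8 : C * p * e ^ 2 ≤ C ^ 2 * e ^ 2 := by
      rw [pow_two C]
      gcongr
    nlinarith
  have h9 : C * -(a * (G * h)) ≤ C * (G * (|a| * |h|)) := by gcongr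
  have h10 : |h| * |h| = h ^ 2 := by rw [← pow_two, sq_abs]
  have e1 : G * ((8 * C * |a| + 2 * |h|) * |h|) = 8 * (C * (G * (|a| * |h|))) + 2 * (G * h ^ 2) := by
    rw [← h10]; ring
  have e2 : G' * (a + e) * η = p * (a + e) := by rw [hp]; ring
  rw [e1]
  rw [e2] at h1 ⊢
  nlinarith

theorem integrableOn_mul_abs_of_tsupport_subset {U : Set (EuclideanSpace ℝ (Fin d))}
    (hU : IsOpen U) {a a' b : EuclideanSpace ℝ (Fin d) → ℝ} (ha : ContinuousOn a U)
    (ha' : ContinuousOn a' U) (hb : Continuous b) (hbc : HasCompactSupport b)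
    (hbU : tsupport b ⊆ U) (c : ℝ) :
    IntegrableOn (fun x => a x * ((c * |a' x| + 2 * |b x|) * |b x|)) U := by
  simp_rw [← mul_assoc]
  exact (integrable_mul_of_continuousOn_of_tsupport_subset hU
    (ha.mul ((continuousOn_const.mul ha'.abs).add (continuousOn_const.mul
      hb.abs.continuousOn))) hb.abs (hbc.comp_left abs_zero)
    ((tsupport_comp_subset abs_zero b).trans hbU)).integrableOn

/-- Energy estimate for the truncation `η G(u + e)` of a harmonic function `u`. -/
theorem InnerProductSpace.HarmonicOnNhd.integral_cutoff_sq_le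
    {u : EuclideanSpace ℝ (Fin d) → ℝ}
    (hu : HarmonicOnNhd u (Ω : Set (EuclideanSpace ℝ (Fin d)))) (i : Fin d) {R : ℝ}
    (hR : ∀ x ∈ (Ω : Set (EuclideanSpace ℝ (Fin d))), |x i| ≤ R) {G : ℝ → ℝ} {C : ℝ}
    (hG : ContDiff ℝ 1 G) (hG01 : ∀ s, G s ∈ Icc (0 : ℝ) 1)
    (hG' : ∀ s, deriv G s ∈ Icc 0 C) (e η : 𝓓(Ω, ℝ)) (hη : ∀ x, η x ∈ Icc (0 : ℝ) 1) :
    ∫ x in (Ω : Set (EuclideanSpace ℝ (Fin d))), (G (u x + e x) * η x) ^ 2 ≤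
      4 * R ^ 2 * (8 * C ^ 2 * (∑ j, ∫ x in (Ω : Set (EuclideanSpace ℝ (Fin d))),
          fderiv ℝ e x (EuclideanSpace.single j 1) ^ 2) +
        ∑ j, ∫ x in (Ω : Set (EuclideanSpace ℝ (Fin d))), G (u x + e x) *
          ((8 * C * |fderiv ℝ u x (EuclideanSpace.single j 1)| +
            2 * |fderiv ℝ η x (EuclideanSpace.single j 1)|) *
              |fderiv ℝ η x (EuclideanSpace.single j 1)|)) := by
  have he1 : ContDiff ℝ 1 e := e.contDiff.of_le (mod_cast le_top)
  have hη1 : ContDiff ℝ 1 η := η.contDiff.of_le (mod_cast le_top)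
  have hu1 : ContDiffOn ℝ 1 u Ω := hu.contDiffOn.of_le (by norm_num)
  have hq : ContDiffOn ℝ 1 (fun x => G (u x + e x)) Ω :=
    hG.comp_contDiffOn (hu1.add he1.contDiffOn)
  set f : EuclideanSpace ℝ (Fin d) → ℝ := fun x => G (u x + e x) * η x with hfdef
  have hf : ContDiff ℝ 1 f := contDiff_mul_of_tsupport_subset Ω.isOpen hq hη1 η.tsupport_subset
  have hfc : HasCompactSupport f := η.hasCompactSupport.mul_left
  have hfΩ : tsupport f ⊆ Ω := tsupport_mul_subset_right.trans η.tsupport_subset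
  have hfd : ∀ x ∈ (Ω : Set (EuclideanSpace ℝ (Fin d))), ∀ v, fderiv ℝ f x v =
      deriv G (u x + e x) * (fderiv ℝ u x v + fderiv ℝ e x v) * η x +
        G (u x + e x) * fderiv ℝ η x v := by
    intro x hx v
    have h1 := (hu1.contDiffAt (Ω.isOpen.mem_nhds hx)).differentiableAt one_ne_zero
    have h2 := (he1.differentiable one_ne_zero) x
    have h3 := ((hG.differentiable one_ne_zero) (u x + e x)).hasDerivAt.comp_hasFDerivAt x
      (h1.hasFDerivAt.fun_add h2.hasFDerivAt)
    have h4 := h3.mul ((hη1.differentiable one_ne_zero) x).hasFDerivAt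
    have h5 : fderiv ℝ f x = _ := h4.fderiv
    rw [h5]
    simp
    ring
  have hpoinc : ∫ x in (Ω : Set (EuclideanSpace ℝ (Fin d))), f x ^ 2 ≤
      4 * R ^ 2 * ∫ x in (Ω : Set (EuclideanSpace ℝ (Fin d))),
        fderiv ℝ f x (EuclideanSpace.single i 1) ^ 2 := by
    simp_rw [pow_two (fderiv ℝ _ _ _), pow_two (f _)]
    rw [setIntegral_eq_integral_of_tsupport_subset hfΩ,
      setIntegral_eq_integral_of_tsupport_subset
        ((tsupport_fderiv_apply_subset ℝ _).trans hfΩ)]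
    simp_rw [← pow_two (fderiv ℝ _ _ _), ← pow_two (f _)]
    exact integral_sq_le_integral_fderiv_sq i hf hfc
      (fun x hx => hR x (hfΩ (subset_tsupport _ hx)))
  refine hpoinc.trans (mul_le_mul_of_nonneg_left ?_ (by positivity))
  have hfi : ∀ j, Integrable (fun x => fderiv ℝ f x (EuclideanSpace.single j 1) ^ 2)
      (volume.restrict (Ω : Set (EuclideanSpace ℝ (Fin d)))) := fun j =>
    (((hf.continuous_fderiv one_ne_zero).clm_apply continuous_const).memLp_of_hasCompactSupport
      (hfc.fderiv_apply ℝ _)).integrable_sq.integrableOn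
  have hei : ∀ j, Integrable (fun x => fderiv ℝ e x (EuclideanSpace.single j 1) ^ 2)
      (volume.restrict (Ω : Set (EuclideanSpace ℝ (Fin d)))) := fun j =>
    (e.memLp_fderiv_apply _ _).integrable_sq
  have hui : ∀ j, Integrable (fun x => fderiv ℝ u x (EuclideanSpace.single j 1) *
      fderiv ℝ f x (EuclideanSpace.single j 1))
      (volume.restrict (Ω : Set (EuclideanSpace ℝ (Fin d)))) := fun j =>
    (integrable_mul_of_continuousOn_of_tsupport_subset Ω.isOpen
      (hu1.continuousOn_fderiv_apply Ω.isOpen _)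
      ((hf.continuous_fderiv one_ne_zero).clm_apply continuous_const) (hfc.fderiv_apply ℝ _)
      ((tsupport_fderiv_apply_subset ℝ _).trans hfΩ)).integrableOn
  have hbi : ∀ j, Integrable (fun x => G (u x + e x) *
      ((8 * C * |fderiv ℝ u x (EuclideanSpace.single j 1)| +
        2 * |fderiv ℝ η x (EuclideanSpace.single j 1)|) *
          |fderiv ℝ η x (EuclideanSpace.single j 1)|))
      (volume.restrict (Ω : Set (EuclideanSpace ℝ (Fin d)))) := fun j =>
    integrableOn_mul_abs_of_tsupport_subset Ω.isOpen hq.continuousOn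
      (hu1.continuousOn_fderiv_apply Ω.isOpen _) (η.continuous_fderiv_apply _)
      (η.hasCompactSupport.fderiv_apply ℝ _)
      ((tsupport_fderiv_apply_subset ℝ _).trans η.tsupport_subset) _
  -- Poincaré needs one direction only, but harmonicity kills only the sum over all directions, so
  -- the full gradient enters.
  calc ∫ x in (Ω : Set (EuclideanSpace ℝ (Fin d))), fderiv ℝ f x (EuclideanSpace.single i 1) ^ 2
      ≤ ∑ j, ∫ x in (Ω : Set (EuclideanSpace ℝ (Fin d))),
          fderiv ℝ f x (EuclideanSpace.single j 1) ^ 2 :=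
        Finset.single_le_sum (f := fun j => ∫ x in (Ω : Set (EuclideanSpace ℝ (Fin d))),
          fderiv ℝ f x (EuclideanSpace.single j 1) ^ 2)
          (fun j _ => integral_nonneg fun x => sq_nonneg _) (Finset.mem_univ i)
    _ ≤ ∑ j, ∫ x in (Ω : Set (EuclideanSpace ℝ (Fin d))),
          (8 * C * (fderiv ℝ u x (EuclideanSpace.single j 1) *
              fderiv ℝ f x (EuclideanSpace.single j 1)) +
            8 * C ^ 2 * fderiv ℝ e x (EuclideanSpace.single j 1) ^ 2 +
            G (u x + e x) * ((8 * C * |fderiv ℝ u x (EuclideanSpace.single j 1)| +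
              2 * |fderiv ℝ η x (EuclideanSpace.single j 1)|) *
                |fderiv ℝ η x (EuclideanSpace.single j 1)|)) := by
        refine Finset.sum_le_sum fun j _ => setIntegral_mono_on (hfi j)
          ((((hui j).const_mul _).add ((hei j).const_mul _)).add (hbi j))
          Ω.isOpen.measurableSet fun x hx => ?_
        rw [hfd x hx]
        exact sq_deriv_cutoff_le (hG01 _).1 (hG01 _).2 (hG' _).1 (hG' _).2 (hη x).1 (hη x).2
    _ = _ := by
        have hsplit : ∀ j : Fin d, ∫ x in (Ω : Set (EuclideanSpace ℝ (Fin d))),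
            (8 * C * (fderiv ℝ u x (EuclideanSpace.single j 1) *
                fderiv ℝ f x (EuclideanSpace.single j 1)) +
              8 * C ^ 2 * fderiv ℝ e x (EuclideanSpace.single j 1) ^ 2 +
              G (u x + e x) * ((8 * C * |fderiv ℝ u x (EuclideanSpace.single j 1)| +
                2 * |fderiv ℝ η x (EuclideanSpace.single j 1)|) *
                  |fderiv ℝ η x (EuclideanSpace.single j 1)|)) = _ := fun j =>
          integral_add (((hui j).const_mul _).add ((hei j).const_mul _)) (hbi j)
        have hsplit' : ∀ j : Fin d, ∫ x in (Ω : Set (EuclideanSpace ℝ (Fin d))),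
            (8 * C * (fderiv ℝ u x (EuclideanSpace.single j 1) *
                fderiv ℝ f x (EuclideanSpace.single j 1)) +
              8 * C ^ 2 * fderiv ℝ e x (EuclideanSpace.single j 1) ^ 2) = _ := fun j =>
          integral_add ((hui j).const_mul _) ((hei j).const_mul _)
        simp_rw [hsplit, hsplit', integral_const_mul, Finset.sum_add_distrib, ← Finset.mul_sum]
        rw [hu.sum_integral_fderiv_mul_fderiv_eq_zero hf hfc hfΩ, mul_zero, zero_add]

end Uniqueness

/-! ### Comparison principle and uniqueness -/

theorem tendsto_eLpNorm_two_iff {α : Type*} [MeasurableSpace α] {μ : Measure α}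
    {f : ℕ → α → ℝ} (hf : ∀ n, MemLp (f n) 2 μ) :
    Tendsto (fun n => eLpNorm (f n) 2 μ) atTop (𝓝 0) ↔
      Tendsto (fun n => ∫ x, f n x ^ 2 ∂μ) atTop (𝓝 0) := by
  have h1 : ∀ n, ∫ x, f n x ^ 2 ∂μ = (eLpNorm (f n) 2 μ).toReal ^ 2 := fun n => by
    rw [← norm_toLp_sq (hf n), Lp.norm_toLp]
  simp_rw [h1]
  constructor
  · intro h
    simpa using ((ENNReal.tendsto_toReal ENNReal.zero_ne_top).comp h).pow 2
  · intro h
    have h2 := h.sqrt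
    simp_rw [Real.sqrt_zero, Real.sqrt_sq ENNReal.toReal_nonneg] at h2
    rw [← ENNReal.toReal_zero] at h2
    exact (ENNReal.tendsto_toReal_iff (fun n => (hf n).eLpNorm_ne_top) ENNReal.zero_ne_top).1 h2

/-- Smooth truncations at level `ε`. -/
theorem exists_smooth_truncation (ε : ℝ) :
    ∃ (G : ℝ → ℝ) (C : ℝ), ContDiff ℝ 1 G ∧ (∀ s, G s ∈ Icc (0 : ℝ) 1) ∧
      (∀ s, deriv G s ∈ Icc 0 C) ∧ (∀ s, s ≤ ε → G s = 0) ∧ ∀ s, ε < s → 0 < G s := by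
  have hcd : ContDiff ℝ 1 Real.smoothTransition :=
    Real.smoothTransition.contDiff (n := 1)
  have hcs : HasCompactSupport (deriv Real.smoothTransition) := by
    refine HasCompactSupport.intro (isCompact_Icc (a := (0 : ℝ)) (b := 1)) fun s hs => ?_
    rcases not_and_or.1 hs with h | h
    · have : Real.smoothTransition =ᶠ[𝓝 s] fun _ => 0 := by
        filter_upwards [gt_mem_nhds (not_le.1 h)] with t ht
          using Real.smoothTransition.zero_of_nonpos ht.le
      rw [this.deriv_eq, deriv_const]
    · have : Real.smoothTransition =ᶠ[𝓝 s] fun _ => 1 := by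
        filter_upwards [lt_mem_nhds (not_le.1 h)] with t ht
          using Real.smoothTransition.one_of_one_le ht.le
      rw [this.deriv_eq, deriv_const]
  obtain ⟨C, hC⟩ := (hcd.continuous_deriv le_rfl).bounded_above_of_compact_support hcs
  refine ⟨fun s => Real.smoothTransition (s - ε), C, hcd.comp (contDiff_id.sub contDiff_const),
    fun s => ⟨Real.smoothTransition.nonneg _, Real.smoothTransition.le_one _⟩, fun s => ?_,
    fun s hs => Real.smoothTransition.zero_of_nonpos (sub_nonpos.2 hs),
    fun s hs => Real.smoothTransition.pos_of_pos (sub_pos.2 hs)⟩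
  rw [deriv_comp_sub_const]
  exact ⟨Real.smoothTransition.monotone.deriv_nonneg, (le_abs_self _).trans (hC _)⟩

section Uniqueness

variable {d : ℕ} {Ω : Opens (EuclideanSpace ℝ (Fin d))}

theorem TestFunction.fderiv_sub_apply (w₁ w₂ : 𝓓(Ω, ℝ)) (x v : EuclideanSpace ℝ (Fin d)) :
    fderiv ℝ (w₁ - w₂ : 𝓓(Ω, ℝ)) x v = fderiv ℝ w₁ x v - fderiv ℝ w₂ x v := by
  have h1 := (w₁.contDiff.differentiable (by simp)) x
  have h2 := (w₂.contDiff.differentiable (by simp)) x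
  rw [FunLike.coe_sub, fderiv_sub h1 h2]
  rfl

/-- The cutoff error is nonzero only where `w = 0`, `|Ψ| < ε / 2` and `u + w' > ε`, hence where `w'
- (Ψ - u) ≥ ε / 2`; a Chebyshev bound gives the factor `4 / ε²`. Since `B` is chosen before `w'`,
the approximation `w'` can later be taken good enough to beat `B`. -/
theorem exists_cutoff_integral_sq_le {u Ψ : EuclideanSpace ℝ (Fin d) → ℝ}
    (hu : InnerProductSpace.HarmonicOnNhd u (Ω : Set (EuclideanSpace ℝ (Fin d))))
    (hbdd : Bornology.IsBounded (Ω : Set (EuclideanSpace ℝ (Fin d))))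
    (hΨ : ContinuousOn Ψ (closure (Ω : Set (EuclideanSpace ℝ (Fin d)))))
    (hΨ0 : ∀ z ∈ frontier (Ω : Set (EuclideanSpace ℝ (Fin d))), Ψ z = 0)
    (hv : MemLp (fun x => Ψ x - u x) 2 (volume.restrict (Ω : Set (EuclideanSpace ℝ (Fin d)))))
    (i : Fin d) {R : ℝ} (hR : ∀ x ∈ (Ω : Set (EuclideanSpace ℝ (Fin d))), |x i| ≤ R)
    {G : ℝ → ℝ} {C ε : ℝ} (hε : 0 < ε) (hG : ContDiff ℝ 1 G) (hG01 : ∀ s, G s ∈ Icc (0 : ℝ) 1)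
    (hG' : ∀ s, deriv G s ∈ Icc 0 C) (hGε : ∀ s, s ≤ ε → G s = 0) (w : 𝓓(Ω, ℝ)) :
    ∃ (η : 𝓓(Ω, ℝ)) (B : ℝ),
      (∀ x ∈ (Ω : Set (EuclideanSpace ℝ (Fin d))), w x ≠ 0 ∨ ε / 2 ≤ |Ψ x| → η x = 1) ∧
      ∀ w' : 𝓓(Ω, ℝ),
        ∫ x in (Ω : Set (EuclideanSpace ℝ (Fin d))), (G (u x + (w' x - w x)) * η x) ^ 2 ≤
          4 * R ^ 2 * (8 * C ^ 2 * (∑ j, ∫ x in (Ω : Set (EuclideanSpace ℝ (Fin d))),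
            (fderiv ℝ w' x (EuclideanSpace.single j 1) -
              fderiv ℝ w x (EuclideanSpace.single j 1)) ^ 2) +
            B * ∫ x in (Ω : Set (EuclideanSpace ℝ (Fin d))), (w' x - (Ψ x - u x)) ^ 2) := by
  have hC : 0 ≤ C := (hG' 0).1.trans (hG' 0).2
  -- The second piece avoids the boundary because `Ψ` vanishes there, so `K` is compact inside `Ω`.
  set K := tsupport w ∪ (closure (Ω : Set (EuclideanSpace ℝ (Fin d))) ∩ Ψ ⁻¹' {s | ε / 2 ≤ |s|})
    with hKdef
  have hKc : IsCompact K := by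
    refine w.hasCompactSupport.isCompact.union
      (hbdd.isCompact_closure.of_isClosed_subset ?_ inter_subset_left)
    exact hΨ.preimage_isClosed_of_isClosed isClosed_closure
      (isClosed_le continuous_const continuous_abs)
  have hKΩ : K ⊆ Ω := by
    refine union_subset w.tsupport_subset fun x hx => ?_
    by_contra h
    have h0 := hΨ0 x (by rw [Ω.isOpen.frontier_eq]; exact ⟨hx.1, h⟩)
    have h1 : ε / 2 ≤ |Ψ x| := hx.2
    rw [h0, abs_zero] at h1
    linarith
  obtain ⟨η, hη1, hη⟩ := TestFunction.exists_eventually_eq_one hKc hKΩ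
  have hηK : ∀ x ∈ K, ∀ v, fderiv ℝ η x v = 0 := fun x hx v => by
    have h : (η : EuclideanSpace ℝ (Fin d) → ℝ) =ᶠ[𝓝 x] fun _ => 1 := hη1 x hx
    rw [h.fderiv_eq]
    simp
  have hu1 : ContDiffOn ℝ 1 u Ω := hu.contDiffOn.of_le (by norm_num)
  have hb : ∀ j : Fin d, ∃ B : ℝ, 0 ≤ B ∧ ∀ x ∈ (Ω : Set (EuclideanSpace ℝ (Fin d))),
      (8 * C * |fderiv ℝ u x (EuclideanSpace.single j 1)| +
        2 * |fderiv ℝ η x (EuclideanSpace.single j 1)|) *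
          |fderiv ℝ η x (EuclideanSpace.single j 1)| ≤ B := by
    intro j
    have hηc := η.continuous_fderiv_apply (EuclideanSpace.single j 1)
    have hηcs : HasCompactSupport fun x => |fderiv ℝ η x (EuclideanSpace.single j 1)| :=
      (η.hasCompactSupport.fderiv_apply ℝ (EuclideanSpace.single j 1)).comp_left abs_zero
    have hcont := continuous_mul_of_continuousOn_of_tsupport_subset Ω.isOpen
      (((continuousOn_const (c := 8 * C)).mul (hu1.continuousOn_fderiv_apply Ω.isOpen
        (EuclideanSpace.single j 1)).abs).add
          ((continuousOn_const (c := (2 : ℝ))).mul hηc.abs.continuousOn)) hηc.abs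
      ((tsupport_comp_subset abs_zero _).trans
        ((tsupport_fderiv_apply_subset ℝ _).trans η.tsupport_subset))
    obtain ⟨B, hB⟩ := hcont.bounded_above_of_compact_support hηcs.mul_left
    exact ⟨B, (norm_nonneg _).trans (hB 0), fun x _ => (le_abs_self _).trans (hB x)⟩
  choose B hB0 hB using hb
  refine ⟨η, ∑ j, B j * (4 / ε ^ 2), fun x hx h => ?_, fun w' => ?_⟩
  · refine (hη1 x ?_).self_of_nhds
    exact h.imp (fun h => subset_tsupport _ h) fun h => ⟨subset_closure hx, h⟩
  have hmain := hu.integral_cutoff_sq_le i hR hG hG01 hG' (w' - w) η hη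
  simp_rw [TestFunction.fderiv_sub_apply] at hmain
  refine hmain.trans ?_
  gcongr
  rw [Finset.sum_mul]
  refine Finset.sum_le_sum fun j _ => ?_
  rw [← integral_const_mul]
  have hq : ContinuousOn (fun x => G (u x + (w' - w : 𝓓(Ω, ℝ)) x)) Ω :=
    hG.continuous.comp_continuousOn (hu1.continuousOn.add (w' - w).continuous.continuousOn)
  refine setIntegral_mono_on (integrableOn_mul_abs_of_tsupport_subset Ω.isOpen hq
    (hu1.continuousOn_fderiv_apply Ω.isOpen _) (η.continuous_fderiv_apply _)
    (η.hasCompactSupport.fderiv_apply ℝ _)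
    ((tsupport_fderiv_apply_subset ℝ _).trans η.tsupport_subset) _)
    (((w'.memLp _).sub hv).integrable_sq.const_mul _) Ω.isOpen.measurableSet fun x hx => ?_
  have hrhs : 0 ≤ B j * (4 / ε ^ 2) * (w' x - (Ψ x - u x)) ^ 2 := by
    have := hB0 j
    positivity
  by_cases hηx : fderiv ℝ η x (EuclideanSpace.single j 1) = 0
  · rw [hηx, abs_zero, mul_zero, mul_zero]
    exact hrhs
  have hxK : x ∉ K := fun h => hηx (hηK x h _)
  have hwx : w x = 0 := by
    by_contra h
    exact hxK (.inl (subset_tsupport _ h))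
  have hΨx : |Ψ x| < ε / 2 := by
    by_contra h
    exact hxK (.inr ⟨subset_closure hx, not_lt.1 h⟩)
  have hsub : (w' - w : 𝓓(Ω, ℝ)) x = w' x - w x := rfl
  rw [hsub, hwx, sub_zero]
  rcases le_or_gt (u x + w' x) ε with hle | hgt
  · rw [hGε _ hle, zero_mul]
    exact hrhs
  have h1 : ε / 2 ≤ w' x - (Ψ x - u x) := by
    have := le_of_abs_le hΨx.le
    linarith
  have h2 : 1 ≤ 4 / ε ^ 2 * (w' x - (Ψ x - u x)) ^ 2 := by
    rw [div_mul_eq_mul_div, le_div_iff₀ (by positivity)]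
    nlinarith
  calc G (u x + w' x) * _ ≤ 1 * B j :=
        mul_le_mul (hG01 _).2 (hB j x hx) (by positivity) zero_le_one
    _ ≤ B j * (4 / ε ^ 2 * (w' x - (Ψ x - u x)) ^ 2) := by
        rw [one_mul]
        exact le_mul_of_one_le_right (hB0 j) h2
    _ = _ := by ring

/-- Comparison principle behind uniqueness: a harmonic function that is the difference of a
continuous function vanishing on the boundary and a function in `H¹₀(Ω)` is nonpositive. -/
theorem InnerProductSpace.HarmonicOnNhd.nonpos_of_sub_memH10 (hd : 0 < d)
    {u Ψ : EuclideanSpace ℝ (Fin d) → ℝ}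
    (hu : InnerProductSpace.HarmonicOnNhd u (Ω : Set (EuclideanSpace ℝ (Fin d))))
    (hbdd : Bornology.IsBounded (Ω : Set (EuclideanSpace ℝ (Fin d))))
    (hΨ : ContinuousOn Ψ (closure (Ω : Set (EuclideanSpace ℝ (Fin d)))))
    (hΨ0 : ∀ z ∈ frontier (Ω : Set (EuclideanSpace ℝ (Fin d))), Ψ z = 0)
    (h : MemH10 Ω fun x => Ψ x - u x) :
    ∀ x ∈ (Ω : Set (EuclideanSpace ℝ (Fin d))), u x ≤ 0 := by
  set μ := volume.restrict (Ω : Set (EuclideanSpace ℝ (Fin d))) with hμ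
  obtain ⟨g, hg, w₀, hw₀, hw₀'⟩ := h
  -- Pass to a subsequence of the approximating test functions that also converges almost
  -- everywhere.
  obtain ⟨ns, hns, hae⟩ := (tendstoInMeasure_of_tendsto_eLpNorm two_ne_zero
    (fun n => ((w₀ n).continuous.aestronglyMeasurable : AEStronglyMeasurable _ μ))
    hg.memLp.aestronglyMeasurable hw₀).exists_seq_tendsto_ae
  set w : ℕ → 𝓓(Ω, ℝ) := fun n => w₀ (ns n) with hwdef
  have hA : Tendsto (fun n => ∫ x, (w n x - (Ψ x - u x)) ^ 2 ∂μ) atTop (𝓝 0) :=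
    (tendsto_eLpNorm_two_iff fun n => ((w n).memLp _).sub hg.memLp).1 (hw₀.comp hns.tendsto_atTop)
  have hZj : ∀ j, Tendsto (fun n => ∫ x, (fderiv ℝ (w n) x (EuclideanSpace.single j 1) - g j x) ^ 2
      ∂μ) atTop (𝓝 0) := fun j =>
    (tendsto_eLpNorm_two_iff fun n => ((w n).memLp_fderiv_apply _ _).sub (hg.memLp_grad j)).1
      ((hw₀' j).comp hns.tendsto_atTop)
  set Z : ℕ → ℝ := fun n => ∑ j, ∫ x, (fderiv ℝ (w n) x (EuclideanSpace.single j 1) - g j x) ^ 2 ∂μ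
    with hZdef
  have hZ : Tendsto Z atTop (𝓝 0) := by
    simpa using tendsto_finsetSum Finset.univ fun j _ => hZj j
  have hZle : ∀ m n, ∑ j, ∫ x, (fderiv ℝ (w m) x (EuclideanSpace.single j 1) -
      fderiv ℝ (w n) x (EuclideanSpace.single j 1)) ^ 2 ∂μ ≤ 2 * Z m + 2 * Z n := by
    intro m n
    simp only [hZdef, Finset.mul_sum]
    rw [← Finset.sum_add_distrib]
    refine Finset.sum_le_sum fun j _ => ?_
    have hi : ∀ n, Integrable (fun x => (fderiv ℝ (w n) x (EuclideanSpace.single j 1) - g j x) ^ 2)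
        μ := fun n => (((w n).memLp_fderiv_apply _ _).sub (hg.memLp_grad j)).integrable_sq
    rw [← integral_const_mul, ← integral_const_mul,
      ← integral_add ((hi m).const_mul 2) ((hi n).const_mul 2)]
    refine integral_mono
      (((w m).memLp_fderiv_apply _ _).sub ((w n).memLp_fderiv_apply _ _)).integrable_sq
      (((hi m).const_mul 2).add ((hi n).const_mul 2)) fun x => ?_
    simp only
    nlinarith [sq_nonneg ((fderiv ℝ (w m) x (EuclideanSpace.single j 1) - g j x) +
      (fderiv ℝ (w n) x (EuclideanSpace.single j 1) - g j x))]
  obtain ⟨R, hR⟩ : ∃ R : ℝ, ∀ x ∈ (Ω : Set (EuclideanSpace ℝ (Fin d))), |x ⟨0, hd⟩| ≤ R := by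
    obtain ⟨R, hR⟩ := hbdd.exists_norm_le
    refine ⟨R, fun x hx => ?_⟩
    have := (PiLp.norm_apply_le x ⟨0, hd⟩).trans (hR x hx)
    rwa [Real.norm_eq_abs] at this
  suffices H : ∀ ε > 0, ∀ x ∈ (Ω : Set (EuclideanSpace ℝ (Fin d))), u x ≤ ε from
    fun x hx => le_of_forall_pos_le_add fun ε hε => by simpa using H ε hε x hx
  intro ε hε
  obtain ⟨G, C, hG, hG01, hG', hGε, hGpos⟩ := exists_smooth_truncation ε
  choose η B hη hB using fun n => exists_cutoff_integral_sq_le hu hbdd hΨ hΨ0 hg.memLp ⟨0, hd⟩ hR hε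
    hG hG01 hG' hGε (w n)
  -- Nothing bounds `B n` as `n` grows; choosing `m` after `n` compensates for this.
  have hm : ∀ n : ℕ, ∃ m, n ≤ m ∧ B n * ∫ x, (w m x - (Ψ x - u x)) ^ 2 ∂μ < 1 / ((n : ℝ) + 1) := by
    intro n
    have h1 := hA.const_mul (B n)
    rw [mul_zero] at h1
    exact ((eventually_ge_atTop n).and (h1.eventually_lt_const Nat.one_div_pos_of_nat)).exists
  choose m hnm hm using hm
  set f : ℕ → EuclideanSpace ℝ (Fin d) → ℝ :=
    fun n x => G (u x + (w (m n) x - w n x)) * η n x with hfdef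
  have hmt : Tendsto m atTop atTop := tendsto_atTop_mono hnm tendsto_id
  have hfint : Tendsto (fun n => ∫ x, f n x ^ 2 ∂μ) atTop (𝓝 0) := by
    refine squeeze_zero (fun n => integral_nonneg fun x => sq_nonneg _)
      (fun n => (hB n (w (m n))).trans
        (mul_le_mul_of_nonneg_left (add_le_add (mul_le_mul_of_nonneg_left (hZle (m n) n)
        (by positivity)) (hm n).le) (by positivity))) ?_
    have h1 : Tendsto (fun n => 4 * R ^ 2 * (8 * C ^ 2 * (2 * Z (m n) + 2 * Z n) +
        1 / ((n : ℝ) + 1))) atTop (𝓝 (4 * R ^ 2 * (8 * C ^ 2 * (2 * 0 + 2 * 0) + 0))) :=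
      (((((hZ.comp hmt).const_mul 2).add (hZ.const_mul 2)).const_mul _).add
        tendsto_one_div_add_atTop_nhds_zero_nat).const_mul _
    simpa using h1
  have huc : ContinuousOn u Ω := hu.continuousOn
  have hfLp : ∀ n, MemLp (f n) 2 μ := fun n => by
    have hc : Continuous (f n) := continuous_mul_of_continuousOn_of_tsupport_subset Ω.isOpen
      (hG.continuous.comp_continuousOn
        (huc.add ((w (m n)).continuous.sub (w n).continuous).continuousOn))
      (η n).continuous (η n).tsupport_subset
    exact (hc.memLp_of_hasCompactSupport (η n).hasCompactSupport.mul_left).restrict _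
  have hf0 := (tendsto_eLpNorm_two_iff hfLp).2 hfint
  obtain ⟨ks, hks, hfae⟩ := (tendstoInMeasure_of_tendsto_eLpNorm two_ne_zero
    (fun n => (hfLp n).aestronglyMeasurable)
    (g := fun _ => 0) aestronglyMeasurable_const
    (hf0.congr fun n => congrArg (eLpNorm · 2 μ)
      (funext fun x => (sub_zero _).symm))).exists_seq_tendsto_ae
  have hle : ∀ᵐ x ∂μ, u x ≤ ε := by
    filter_upwards [hae, hfae, ae_restrict_mem Ω.isOpen.measurableSet] with x hx hfx hxΩ
    by_contra! hlt
    have hwx : Tendsto (fun n => w n x) atTop (𝓝 (Ψ x - u x)) := hx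
    -- Otherwise `w n x = 0` and `|Ψ x| < ε / 2` for some `n` with `w n x` within `ε / 2` of `Ψ x -
    -- u x`, which forces `u x < ε`.
    have hη1 : ∀ᶠ n in atTop, η n x = 1 := by
      have h1 := (hwx.dist (tendsto_const_nhds (x := Ψ x - u x)))
      rw [dist_self] at h1
      filter_upwards [h1.eventually_lt_const (half_pos hε)] with n hn
      refine hη n x hxΩ ?_
      by_contra! hcon
      rw [hcon.1, Real.dist_eq, zero_sub, abs_neg] at hn
      have h2 := (abs_lt.1 hn).1
      have h3 := (abs_lt.1 hcon.2).2
      linarith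
    have hlim : Tendsto (fun n => f n x) atTop (𝓝 (G (u x))) := by
      have h2 : Tendsto (fun n => G (u x + (w (m n) x - w n x))) atTop
          (𝓝 (G (u x + ((Ψ x - u x) - (Ψ x - u x))))) :=
        (hG.continuous.tendsto _).comp (((hwx.comp hmt).sub hwx).const_add (u x))
      rw [sub_self, add_zero] at h2
      refine h2.congr' ?_
      filter_upwards [hη1] with n hn
      rw [hfdef]
      simp [hn]
    exact (hGpos _ hlt).ne' (tendsto_nhds_unique (hlim.comp hks.tendsto_atTop) hfx)
  -- By continuity of `u`, the almost everywhere bound holds everywhere: an open null set is empty.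
  have hopen : IsOpen ((Ω : Set (EuclideanSpace ℝ (Fin d))) ∩ u ⁻¹' Ioi ε) :=
    huc.isOpen_inter_preimage Ω.isOpen isOpen_Ioi
  have hnull : volume ((Ω : Set (EuclideanSpace ℝ (Fin d))) ∩ u ⁻¹' Ioi ε) = 0 := by
    rw [hμ, ae_restrict_iff' Ω.isOpen.measurableSet] at hle
    refine measure_mono_null (fun x hx => ?_) hle
    exact fun h => not_lt.2 (h hx.1) hx.2
  have hempty := hopen.eq_empty_of_measure_zero hnull
  intro x hx
  by_contra! hlt
  exact (hempty ▸ (⟨hx, hlt⟩ : x ∈ (Ω : Set (EuclideanSpace ℝ (Fin d))) ∩ u ⁻¹' Ioi ε) :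
    x ∈ (∅ : Set (EuclideanSpace ℝ (Fin d))))

theorem MemH10.sub {u v : EuclideanSpace ℝ (Fin d) → ℝ} (hu : MemH10 Ω u) (hv : MemH10 Ω v) :
    MemH10 Ω fun x => u x - v x := by
  obtain ⟨g₁, hg₁, w₁, h₁, h₁'⟩ := hu
  obtain ⟨g₂, hg₂, w₂, h₂, h₂'⟩ := hv
  have key : ∀ (a b : ℕ → EuclideanSpace ℝ (Fin d) → ℝ),
      (∀ n, MemLp (a n) 2 (volume.restrict (Ω : Set (EuclideanSpace ℝ (Fin d))))) →
      (∀ n, MemLp (b n) 2 (volume.restrict (Ω : Set (EuclideanSpace ℝ (Fin d))))) →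
      Tendsto (fun n => eLpNorm (a n) 2
        (volume.restrict (Ω : Set (EuclideanSpace ℝ (Fin d))))) atTop (𝓝 0) →
      Tendsto (fun n => eLpNorm (b n) 2
        (volume.restrict (Ω : Set (EuclideanSpace ℝ (Fin d))))) atTop (𝓝 0) →
      Tendsto (fun n => eLpNorm (a n - b n) 2
        (volume.restrict (Ω : Set (EuclideanSpace ℝ (Fin d))))) atTop (𝓝 0) := by
    intro a b ha hb h h'
    have h3 := h.add h'
    rw [add_zero] at h3
    exact tendsto_of_tendsto_of_tendsto_of_le_of_le tendsto_const_nhds h3 (fun _ => zero_le)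
      fun n => eLpNorm_sub_le (ha n).aestronglyMeasurable (hb n).aestronglyMeasurable one_le_two
  refine ⟨_, hg₁.sub hg₂, fun n => w₁ n - w₂ n, ?_, fun j => ?_⟩
  · refine (key _ _ (fun n => ((w₁ n).memLp _).sub hg₁.memLp)
      (fun n => ((w₂ n).memLp _).sub hg₂.memLp) h₁ h₂).congr fun n => ?_
    congr 1
    ext x
    change (w₁ n x - u x) - (w₂ n x - v x) = (w₁ n x - w₂ n x) - (u x - v x)
    ring
  · refine (key _ _ (fun n => ((w₁ n).memLp_fderiv_apply _ _).sub (hg₁.memLp_grad j))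
      (fun n => ((w₂ n).memLp_fderiv_apply _ _).sub (hg₂.memLp_grad j)) (h₁' j) (h₂' j)).congr
      fun n => ?_
    congr 1
    ext x
    rw [TestFunction.fderiv_sub_apply]
    simp only [Pi.sub_apply]
    ring

/-- The two solutions may come with different extensions; their difference is continuous and
vanishes on the boundary, which is all the comparison principle asks of `Ψ`. -/
theorem IsVariationalSolution.le_of_isVariationalSolution (hd : 0 < d)
    (hbdd : Bornology.IsBounded (Ω : Set (EuclideanSpace ℝ (Fin d))))
    {φ : C(frontier (Ω : Set (EuclideanSpace ℝ (Fin d))), ℝ)}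
    {u u' : EuclideanSpace ℝ (Fin d) → ℝ} (h : IsVariationalSolution Ω φ u)
    (h' : IsVariationalSolution Ω φ u') :
    ∀ x ∈ (Ω : Set (EuclideanSpace ℝ (Fin d))), u x ≤ u' x := by
  obtain ⟨hu, Φ, hΦ, hΦφ, hH⟩ := h
  obtain ⟨hu', Φ', hΦ', hΦφ', hH'⟩ := h'
  intro x hx
  refine sub_nonpos.1 ((hu.sub hu').nonpos_of_sub_memH10 hd hbdd (hΦ.sub hΦ')
    (fun z hz => ?_) ?_ x hx)
  · rw [Pi.sub_apply, hΦφ ⟨z, hz⟩, hΦφ' ⟨z, hz⟩, sub_self]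
  · convert hH.sub hH' using 2
    simp only [Pi.sub_apply]
    ring

end Uniqueness

/-- Lipschitz boundary data `φ` have a variational solution `u_φ`, unique as a function on `Ω`,
and it is in `H¹(Ω)`, i.e. it has finite energy. -/
theorem corollary2p8 {d : ℕ} (hd : 2 ≤ d) (Ω : Opens (EuclideanSpace ℝ (Fin d)))
    (hconn : IsConnected (Ω : Set (EuclideanSpace ℝ (Fin d))))
    (hbdd : Bornology.IsBounded (Ω : Set (EuclideanSpace ℝ (Fin d))))
    (φ : C(frontier (Ω : Set (EuclideanSpace ℝ (Fin d))), ℝ))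
    (hφ : ∃ K : ℝ≥0, LipschitzWith K φ) :
    ∃ u : EuclideanSpace ℝ (Fin d) → ℝ,
      IsVariationalSolution Ω φ u ∧
      (∀ u' : EuclideanSpace ℝ (Fin d) → ℝ, IsVariationalSolution Ω φ u' →
        EqOn u' u (Ω : Set (EuclideanSpace ℝ (Fin d)))) ∧
      MemH1 Ω u ∧
      (∫⁻ x in (Ω : Set (EuclideanSpace ℝ (Fin d))), ‖gradient u x‖ₑ ^ 2) < ⊤ := by
  have hd0 : 0 < d := by omega
  obtain ⟨K, hK⟩ := hφ
  obtain ⟨u, g, hu, hg⟩ := exists_isVariationalSolution hd0 hbdd hK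
  exact ⟨u, hu, fun u' hu' x hx =>
    le_antisymm (hu'.le_of_isVariationalSolution hd0 hbdd hu x hx)
      (hu.le_of_isVariationalSolution hd0 hbdd hu' x hx),
    ⟨g, hg⟩, hg.lintegral_gradient_lt_top (hu.1.contDiffOn.of_le (by norm_num))⟩
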